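/- A complete curve is a sequence of oriented segments $C_k=[x_k,x_k+\varepsilon_k]$, $k\in\mathbb{Z}$, with $x_k\in\mathbb{Z}+i\mathbb{Z}$, $\varepsilon_k\in\{1,-1,i,-i\}$, $x_{k+1}=x_k+\varepsilon_k$ and $\varepsilon_{k+1}=i^{a_k}\varepsilon_k$, where $a_k\in\{+1,-1\}$; it is associated to the sequence $(a_k)_{k\in\mathbb{Z}}$. Curves $(C_k)_{k\geq 1}$ associated to sequences $(a_k)_{k\geq 1}$ are defined similarly, and their origin is $x_1$. For $S=(a_1,\dots,a_m)$ put $\overline{S}=(-a_m,\dots,-a_1)$. The $0$-folding sequence is empty, and the $(n+1)$-folding sequences are the sequences $(\overline{S},\pm1,S)$ with $S$ an $n$-folding sequence. An $\infty$-folding sequence is a sequence $(a_k)_{k\geq1}$ such that $(a_1,\dots,a_{2^n-1})$ is an $n$-folding sequence for each $n$. A complete folding curve is a complete curve associated to a sequence $(a_k)_{k\in\mathbb{Z}}$ each of whose finite blocks of consecutive terms is a block of consecutive terms of an $n$-folding sequence for some $n$. The alternating folding sequence is the $\infty$-folding sequence with $a_{2^n}=(-1)^n$ for each $n\geq 0$.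 The derivative of $(a_k)_{k\geq1}$ is $(a_{2k})_{k\geq1}$, and the primitives of an $\infty$-folding sequence $T$ are the $\infty$-folding sequences that have $T$ as an iterated derivative. A set $\mathcal{C}$ of complete curves is a covering of the plane if each nonoriented interval $[z,z+\varepsilon]$ with $z\in\mathbb{Z}+i\mathbb{Z}$ and $\varepsilon\in\{1,i\}$ is the support of exactly one segment of one curve of $\mathcal{C}$. It satisfies the local isomorphism property if, for each finite set $F$ of such intervals, there is an $r$ such that each disk of radius $r$ centered at a Gaussian integer contains a translate $F+u$, $u\in\mathbb{Z}+i\mathbb{Z}$, such that any $e,f\in F$ are the supports of consecutive segments of a curve of $\mathcal{C}$ if and only if $e+u,f+u$ are. It is generated by a curve $D=(C_k)_{k\geq 1}$ if each of the four images of $D$ under the rotations of angles $0,\pi/2,\pi,3\pi/2$ about its origin is contained, up to orientation, in a curve of $\mathcal{C}$. **Theorem.** Let $\mathcal{C}$ be a covering of the plane by complete folding curves which satisfies the local isomorphism property. Then one of the two following properties is true: 1) $\mathcal{C}$ consists of $1$, $2$, $3$ or $4$ curves; 2) $\mathcal{C}$ consists of $6$ curves, and $\mathcal{C}$ is generated by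 a curve associated to the alternating folding sequence or to one of its primitives. -/

import Mathlib

namespace PaperFolding

/-- The imaginary unit of the Gaussian integers. -/
def gi : GaussianInt := ⟨0, 1⟩

/-- The four unit vectors `1, -1, i, -i`. -/
def unitVectors : Set GaussianInt := {1, -1, gi, -gi}

/-! ### Folding sequences. Signs `+1`, `-1` are the elements of `ℤˣ`. -/

/-- `(a₁, …, aₘ) ↦ (-aₘ, …, -a₁)`: the turns of a curve that is described backwards. -/
def bar (S : List ℤˣ) : List ℤˣ := S.reverse.map fun a => -a

/-- `n`-folding sequences. Fold a strip in two, then fold the doubled strip `n` times: described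
from the first crease outwards, both halves carry the same `n`-folding sequence `S`, so that the
unfolded strip carries `(bar S, ε, S)`, where `ε` is the sign of the first crease. -/
inductive IsFoldingSeq : ℕ → List ℤˣ → Prop
  | zero : IsFoldingSeq 0 []
  | succ (n : ℕ) (S : List ℤˣ) (ε : ℤˣ) (h : IsFoldingSeq n S) :
      IsFoldingSeq (n + 1) (bar S ++ ε :: S)

/-- `∞`-folding sequences `(a₁, a₂, …)`; the term `aₖ₊₁` is written `a k`.
Each initial part `(a₁, …, a_{2ⁿ-1})` is an `n`-folding sequence. -/
def IsInfFoldingSeq (a : ℕ → ℤˣ) : Prop :=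
  ∀ n : ℕ, IsFoldingSeq n ((List.range (2 ^ n - 1)).map a)

/-- Complete folding sequences `(aₖ)`, `k ∈ ℤ`: each block `(aₖ₊₁, …, aₖ₊ₗ)` occurs (as a block of
consecutive terms) in an `n`-folding sequence for some `n`. -/
def IsCompleteFoldingSeq (a : ℤ → ℤˣ) : Prop :=
  ∀ (k : ℤ) (l : ℕ), ∃ (n : ℕ) (S : List ℤˣ), IsFoldingSeq n S ∧
    ((List.range l).map fun j : ℕ => a (k + 1 + j)) <:+: S

/-- The derivative `(a₂, a₄, a₆, …)` of `(a₁, a₂, a₃, …)`. -/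
def derivedSeq (a : ℕ → ℤˣ) : ℕ → ℤˣ := fun k => a (2 * k + 1)

/-- The alternating folding sequence: the `∞`-folding sequence with `a_{2ⁿ} = (-1)ⁿ` for all `n`. -/
def IsAlternatingSeq (a : ℕ → ℤˣ) : Prop :=
  IsInfFoldingSeq a ∧ ∀ n : ℕ, a (2 ^ n - 1) = (-1) ^ n

/-- The alternating folding sequence (`k = 0`) and its successive primitives: the `∞`-folding
sequences of which some iterated derivative is the alternating folding sequence. -/
def IsAlternatingOrPrimitive (a : ℕ → ℤˣ) : Prop :=
  IsInfFoldingSeq a ∧ ∃ k : ℕ, IsAlternatingSeq (derivedSeq^[k] a)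

/-! ### Curves -/

/-- A complete curve: segments `[xₖ, xₖ + εₖ]`, `k ∈ ℤ`, with `xₖ + εₖ = xₖ₊₁` and
`εₖ₊₁ = i ^ aₖ * εₖ`; note that `i ^ a = a * i` for `a = ±1`. -/
structure CompleteCurve where
  /-- the initial points `xₖ` -/
  pt : ℤ → GaussianInt
  /-- the directions `εₖ` -/
  dir : ℤ → GaussianInt
  /-- the sequence `aₖ` to which the curve is associated -/
  turn : ℤ → ℤˣ
  dir_mem : ∀ k, dir k ∈ unitVectors
  pt_succ : ∀ k, pt (k + 1) = pt k + dir k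
  dir_succ : ∀ k, dir (k + 1) = ((turn k : ℤ) : GaussianInt) * gi * dir k

/-- A curve with an origin and infinitely many segments; the numbering starts at `0`, so that
`turn k` stands for `aₖ₊₁`. -/
structure HalfCurve where
  pt : ℕ → GaussianInt
  dir : ℕ → GaussianInt
  turn : ℕ → ℤˣ
  dir_mem : ∀ k, dir k ∈ unitVectors
  pt_succ : ∀ k, pt (k + 1) = pt k + dir k
  dir_succ : ∀ k, dir (k + 1) = ((turn k : ℤ) : GaussianInt) * gi * dir k

/-- The support of the `k`-th segment: a nonoriented interval, given by its two endpoints. -/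
def CompleteCurve.support (c : CompleteCurve) (k : ℤ) : Sym2 GaussianInt :=
  s(c.pt k, c.pt k + c.dir k)

/-- A complete folding curve. -/
def CompleteCurve.IsFolding (c : CompleteCurve) : Prop := IsCompleteFoldingSeq c.turn

/-- The nonoriented intervals `[z, z + 1]` and `[z, z + i]`, `z` a Gaussian integer. -/
def IsUnitInterval (e : Sym2 GaussianInt) : Prop :=
  ∃ z : GaussianInt, e = s(z, z + 1) ∨ e = s(z, z + gi)

/-! ### Coverings -/

/-- A covering of the plane: each nonoriented unit interval is the support of exactly one segment
of one curve. (In particular two different members never are the same curve with another numbering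
or with the opposite orientation, so that cardinality counts curves.) -/
def IsCovering (C : Set CompleteCurve) : Prop :=
  ∀ e : Sym2 GaussianInt, IsUnitInterval e →
    ∃! p : CompleteCurve × ℤ, p.1 ∈ C ∧ p.1.support p.2 = e

/-- `e` and `f` are the supports of consecutive segments, in either order, of a curve of `C`. -/
def Consecutive (C : Set CompleteCurve) (e f : Sym2 GaussianInt) : Prop :=
  ∃ c ∈ C, ∃ k : ℤ, (c.support k = e ∧ c.support (k + 1) = f) ∨
    (c.support k = f ∧ c.support (k + 1) = e)

/-- The translate of an interval by `u`. -/
def translate (u : GaussianInt) (e : Sym2 GaussianInt) : Sym2 GaussianInt :=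
  e.map fun p => p + u

/-- The local isomorphism property of a covering. A bounded pattern of `C` is given by a finite set
`F` of unit intervals, with the connections of `C` between them. For each such pattern there is a
radius `r` such that each disk of radius `r` contains a translate of it, with the same connections.
Orientations are disregarded. -/
def LocalIsomorphismProperty (C : Set CompleteCurve) : Prop :=
  ∀ F : Finset (Sym2 GaussianInt), (∀ e ∈ F, IsUnitInterval e) →
    ∃ r : ℕ, ∀ z : GaussianInt, ∃ u : GaussianInt,
      (∀ e ∈ F, ∀ p ∈ translate u e, Zsqrtd.norm (p - z) ≤ (r : ℤ) ^ 2) ∧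
      ∀ e ∈ F, ∀ f ∈ F, (Consecutive C e f ↔ Consecutive C (translate u e) (translate u f))

/-- The `k`-th vertex of the image of `D` under the rotation of angle `j * π / 2` about the origin
of `D`. -/
def HalfCurve.rotPt (D : HalfCurve) (j : Fin 4) (k : ℕ) : GaussianInt :=
  D.pt 0 + gi ^ (j : ℕ) * (D.pt k - D.pt 0)

/-- The covering `C` is generated by the curve `D`: the four images of `D` under the rotations of
angles `0, π/2, π, 3π/2` about its origin are, up to orientation, contained in curves of `C`
(they are then connected at the origin so as to form two complete curves of `C`). -/
def IsGeneratedBy (C : Set CompleteCurve) (D : HalfCurve) : Prop :=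
  ∀ j : Fin 4, ∃ c ∈ C, ∃ m : ℤ,
    (∀ k : ℕ, c.pt (m + k) = D.rotPt j k) ∨ (∀ k : ℕ, c.pt (m - k) = D.rotPt j k)

end PaperFolding

/-! At each vertex of a covering the four intervals are joined in two pairs by turns, and this is
possible in only two ways. A covering is thus a field of signs, `vertexState`, and its curves are
the classes of `Conn`. In a complete folding sequence every second term alternates, and the
remaining terms form a complete folding sequence again. Geometrically, a folding curve is made of
pairs of consecutive segments joined at the vertices of one class modulo `1 + i`, where the states
follow the alternating pattern `tw`. Each pair is replaced by one long segment, and the result is a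
folding curve in a lattice that is larger by the factor `1 + i`. A `Letter` records one such step,
and `coarse` sends a segment to the long segment containing it.

A single folding curve has such levels indefinitely (`exists_tower`), and it covers arbitrarily
large boxes (`Tower.exists_box`). By the local isomorphism property every bounded window of the
covering is therefore a translate of a region governed by one stream of letters, and compactness
gives one stream for the whole plane (`exists_letters`). So the entire covering can be coarsened
again and again, and this neither joins nor separates curves (`Conn.coarse_iff`).

Coarsening divides distances by the square root of `2` up to a bounded error, so any finite set of
intervals is finally contained in a small square. A finite computation shows that it then shrinks to
at most four intervals or enters a pinwheel, a figure of eight intervals. Segments of different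
curves never merge. If there are at least five curves, a pinwheel must therefore persist, which
forces its centre to survive at all levels with alternating signs (`Images.pinwheel_succ`). Such a
centre is unique, and every interval of the plane ends up in its pinwheel (`exists_pinwheels`). The
four intervals at the centre are joined there in pairs and there are no other connections, so the
eight intervals represent exactly six curves (`Pinwheels.exists_six`).

A quarter turn about the centre exchanges the two states at every other vertex, so the half curves
issuing from the centre are rotations of each other (`Central.isGeneratedBy`). Their turns of index
`2 ^ n` are the signs of the centre at the successive levels, which alternate from some level on
(`Pinwheels.isAlternatingOrPrimitive`). -/

namespace PaperFolding

/-! ### Folding sequences as interleavings with alternating signs -/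

/-- Alternating signs `μ, -μ, μ, …` interleaved with the terms of a list. -/
def weave : ℤˣ → List ℤˣ → List ℤˣ
  | μ, [] => [μ]
  | μ, x :: L => μ :: x :: weave (-μ) L

theorem length_weave (μ : ℤˣ) (L : List ℤˣ) : (weave μ L).length = 2 * L.length + 1 := by
  induction L generalizing μ with
  | nil => rfl
  | cons x L ih => simp [weave, ih]; ring

/-- The first `weave` uses `L.length + 1` alternating signs, and this determines the sign with which
the second one starts. -/
theorem weave_append (μ x : ℤˣ) (L M : List ℤˣ) :
    weave μ L ++ x :: weave ((-1) ^ (L.length + 1) * μ) M = weave μ (L ++ x :: M) := by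
  induction L generalizing μ with
  | nil => simp [weave]
  | cons y L ih =>
    have h := ih (-μ)
    simp only [weave, List.cons_append, List.length_cons, List.cons.injEq, true_and]
    rw [← h]
    simp [pow_succ]

theorem bar_cons (x : ℤˣ) (S : List ℤˣ) : bar (x :: S) = bar S ++ [-x] := by
  simp [bar]

theorem length_bar (S : List ℤˣ) : (bar S).length = S.length := by
  simp [bar]

theorem bar_weave (μ : ℤˣ) (L : List ℤˣ) :
    bar (weave μ L) = weave ((-1) ^ (L.length + 1) * μ) (bar L) := by
  induction L generalizing μ with
  | nil => simp [weave, bar]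
  | cons x L ih =>
    have h := weave_append ((-1) ^ (L.length + 1) * -μ) (-x) (bar L) []
    rw [length_bar] at h
    simp only [weave, bar_cons, ih, List.length_cons, List.append_assoc]
    rw [show ((-1 : ℤˣ) ^ (L.length + 1 + 1) * μ) = (-1) ^ (L.length + 1) * -μ by simp [pow_succ],
      ← h]
    have : (-1 : ℤˣ) ^ (L.length + 1) * ((-1) ^ (L.length + 1) * -μ) = -μ := by
      rw [← mul_assoc, ← mul_pow]; simp
    rw [this]
    simp [weave]

/-- A folding sequence is described here from its finest creases instead of its first one. Reversal
with change of sign respects the alternation (`bar_weave`), and the middle term falls on a place of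
odd index because a `weave` has odd length. -/
theorem IsFoldingSeq.exists_weave {n : ℕ} {S : List ℤˣ} (h : IsFoldingSeq (n + 1) S) :
    ∃ (μ : ℤˣ) (T : List ℤˣ), IsFoldingSeq n T ∧ S = weave μ T := by
  induction n generalizing S with
  | zero =>
    cases h with
    | succ _ S ε h => cases h; exact ⟨ε, [], .zero, rfl⟩
  | succ n ih =>
    cases h with
    | succ _ S ε h =>
      obtain ⟨μ, T, hT, rfl⟩ := ih h
      refine ⟨(-1) ^ (T.length + 1) * μ, bar T ++ ε :: T, .succ n T ε hT, ?_⟩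
      rw [bar_weave, ← weave_append, length_bar, ← mul_assoc, ← mul_pow]
      simp

theorem IsFoldingSeq.weave {n : ℕ} {T : List ℤˣ} (h : IsFoldingSeq n T) (μ : ℤˣ) :
    IsFoldingSeq (n + 1) (weave μ T) := by
  induction h generalizing μ with
  | zero => exact .succ 0 [] μ .zero
  | succ n S ε h ih =>
    have := IsFoldingSeq.succ _ _ ε (ih ((-1) ^ (S.length + 1) * μ))
    rw [bar_weave, ← mul_assoc, ← mul_pow] at this
    have h2 := weave_append μ ε (bar S) S
    rw [length_bar] at h2
    rw [← h2]
    simpa using this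

theorem weave_getElem?_even (μ : ℤˣ) (T : List ℤˣ) (j : ℕ) (hj : j ≤ T.length) :
    (weave μ T)[2 * j]? = some ((-1) ^ j * μ) := by
  induction j generalizing μ T with
  | zero => cases T <;> simp [PaperFolding.weave]
  | succ j ih =>
    cases T with
    | nil => simp at hj
    | cons x T =>
      have := ih (-μ) T (by simpa using hj)
      rw [show 2 * (j + 1) = 2 * j + 1 + 1 by ring]
      simp [PaperFolding.weave, this, pow_succ]

theorem weave_getElem?_odd (μ : ℤˣ) (T : List ℤˣ) (j : ℕ) :
    (weave μ T)[2 * j + 1]? = T[j]? := by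
  induction j generalizing μ T with
  | zero => cases T <;> simp [PaperFolding.weave]
  | succ j ih =>
    cases T with
    | nil => simp [PaperFolding.weave]
    | cons x T =>
      have := ih (-μ) T
      rw [show 2 * (j + 1) + 1 = 2 * j + 1 + 1 + 1 by ring]
      simp [PaperFolding.weave, this]

/-- A sequence whose terms of even index alternate and whose derivatives behave likewise is
`∞`-folding. -/
theorem isInfFoldingSeq_of_derived (a : ℕ → ℕ → ℤˣ) (θ : ℕ → ℤˣ)
    (h0 : ∀ n j, a n (2 * j) = (-1) ^ j * θ n) (h1 : ∀ n j, a n (2 * j + 1) = a (n + 1) j)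
    (n : ℕ) : IsInfFoldingSeq (a n) := by
  intro m
  induction m generalizing n with
  | zero => exact .zero
  | succ m ih =>
    have h := (ih (n + 1)).weave (θ n)
    convert h using 1
    have hp : 0 < 2 ^ m := by positivity
    apply List.ext_getElem?
    intro i
    obtain ⟨j, rfl | rfl⟩ := Nat.even_or_odd' i
    · by_cases hj : j ≤ 2 ^ m - 1
      · rw [weave_getElem?_even _ _ _ (by simpa using hj)]
        rw [List.getElem?_map, List.getElem?_range (by rw [pow_succ]; omega)]
        simp [h0]
      · rw [List.getElem?_eq_none, List.getElem?_eq_none]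
        · rw [length_weave]; simp; omega
        · simp; rw [pow_succ]; omega
    · rw [weave_getElem?_odd]
      by_cases hj : j < 2 ^ m - 1
      · rw [List.getElem?_map, List.getElem?_range (by rw [pow_succ]; omega),
          List.getElem?_map, List.getElem?_range hj]
        simp [h1]
      · rw [List.getElem?_eq_none, List.getElem?_eq_none]
        · simp; omega
        · simp; rw [pow_succ]; omega

/-- The terms `a k`, `|k| ≤ m`, occur in a folding sequence in such a way that the terms with
`k ≡ q` modulo `2` fall on the alternating places. -/
def BlockWithParity (a : ℤ → ℤˣ) (q : ℤ) (m : ℕ) : Prop :=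
  ∃ (n : ℕ) (S : List ℤˣ) (o : ℤ), IsFoldingSeq (n + 1) S ∧
    ∀ k : ℤ, -m ≤ k → k ≤ m → ∃ i : ℕ, (i : ℤ) = q + k + 2 * o ∧ S[i]? = some (a k)

theorem BlockWithParity.mono {a : ℤ → ℤˣ} {q : ℤ} {m m' : ℕ} (h : BlockWithParity a q m)
    (hm : m' ≤ m) : BlockWithParity a q m' := by
  obtain ⟨n, S, o, hS, h⟩ := h
  exact ⟨n, S, o, hS, fun k h1 h2 => h k (by omega) (by omega)⟩

theorem IsCompleteFoldingSeq.blockWithParity {a : ℤ → ℤˣ} (ha : IsCompleteFoldingSeq a) (m : ℕ) :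
    BlockWithParity a 0 m ∨ BlockWithParity a 1 m := by
  obtain ⟨n, S, hS, P, Q, hPQ⟩ := ha (-m - 1) (2 * m + 1)
  cases n with
  | zero =>
    -- The `0`-folding sequence is empty, whereas the block has `2 * m + 1` terms.
    cases hS
    have := congrArg List.length hPQ
    simp at this
  | succ n =>
    have key : ∀ k : ℤ, -m ≤ k → k ≤ m → ∃ i : ℕ, (i : ℤ) = P.length + m + k ∧
        S[i]? = some (a k) := by
      intro k h1 h2
      refine ⟨P.length + (k + m).toNat, by omega, ?_⟩
      rw [← hPQ, List.append_assoc, List.getElem?_append_right (by omega),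
        List.getElem?_append_left (by simp; omega), List.getElem?_map,
        List.getElem?_range (by omega)]
      simp only [Option.map_some, Option.some.injEq]
      congr 1
      omega
    obtain ⟨o, ho | ho⟩ := Nat.even_or_odd' (P.length + m)
    · exact Or.inl ⟨n, S, o, hS, fun k h1 h2 => by
        obtain ⟨i, hi, h⟩ := key k h1 h2
        exact ⟨i, by omega, h⟩⟩
    · exact Or.inr ⟨n, S, o, hS, fun k h1 h2 => by
        obtain ⟨i, hi, h⟩ := key k h1 h2
        exact ⟨i, by omega, h⟩⟩

/-- `BlockWithParity` is inherited by smaller blocks, so a parity that fails once fails for all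
larger blocks, and the other parity must then serve. -/
theorem IsCompleteFoldingSeq.exists_parity {a : ℤ → ℤˣ} (ha : IsCompleteFoldingSeq a) :
    ∃ q : ℤ, ∀ m, BlockWithParity a q m := by
  by_cases h : ∀ m, BlockWithParity a 0 m
  · exact ⟨0, h⟩
  · push Not at h
    obtain ⟨m₀, h⟩ := h
    refine ⟨1, fun m => ?_⟩
    rcases ha.blockWithParity (max m m₀) with h' | h'
    · exact absurd (h'.mono (le_max_right _ _)) h
    · exact h'.mono (le_max_left _ _)

/-- The structure of a complete folding sequence: every second term alternates, and the other
terms form a complete folding sequence. -/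
theorem IsCompleteFoldingSeq.exists_derived {a : ℤ → ℤˣ} (ha : IsCompleteFoldingSeq a) :
    ∃ q : ℤ, (∀ j : ℤ, a (q + 2 * (j + 1)) = -a (q + 2 * j)) ∧
      IsCompleteFoldingSeq fun j => a (q + 2 * j + 1) := by
  obtain ⟨q, h⟩ := ha.exists_parity
  refine ⟨q, fun j => ?_, fun k l => ?_⟩
  · obtain ⟨n, S, o, hS, h⟩ := h ((q + 2 * j).natAbs + 2)
    obtain ⟨μ, T, hT, rfl⟩ := hS.exists_weave
    obtain ⟨i, hi, h1⟩ := h (q + 2 * j) (by omega) (by omega)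
    obtain ⟨i', hi', h2⟩ := h (q + 2 * (j + 1)) (by omega) (by omega)
    obtain ⟨t, rfl⟩ : ∃ t, i = 2 * t := ⟨i / 2, by omega⟩
    obtain rfl : i' = 2 * (t + 1) := by omega
    have hl : 2 * (t + 1) < (weave μ T).length := by
      by_contra hc
      rw [List.getElem?_eq_none (by omega)] at h2
      simp at h2
    rw [length_weave] at hl
    rw [weave_getElem?_even _ _ _ (by omega)] at h1 h2
    simp only [Option.some.injEq] at h1 h2
    rw [← h1, ← h2]
    simp [pow_succ]
  · obtain ⟨n, S, o, hS, h⟩ := h (q.natAbs + 2 * k.natAbs + 2 * l + 3)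
    obtain ⟨μ, T, hT, rfl⟩ := hS.exists_weave
    refine ⟨n, T, hT, ?_⟩
    have key : ∀ j : ℕ, j < l → ∃ i : ℕ, (i : ℤ) = q + k + 1 + j + o ∧
        T[i]? = some (a (q + 2 * (k + 1 + j) + 1)) := by
      intro j hj
      obtain ⟨i, hi, h1⟩ := h (q + 2 * (k + 1 + j) + 1) (by omega) (by omega)
      obtain ⟨t, rfl⟩ : ∃ t, i = 2 * t + 1 := ⟨i / 2, by omega⟩
      rw [weave_getElem?_odd] at h1
      exact ⟨t, by omega, h1⟩
    rcases Nat.eq_zero_or_pos l with rfl | hl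
    · simp
    obtain ⟨i₀, hi₀, -⟩ := key 0 hl
    have : (List.range l).map (fun j : ℕ => a (q + 2 * (k + 1 + j) + 1)) = (T.drop i₀).take l := by
      apply List.ext_getElem?
      intro j
      by_cases hj : j < l
      · obtain ⟨i, hi, h1⟩ := key j hj
        rw [List.getElem?_take_of_lt hj, List.getElem?_drop, List.getElem?_map,
          List.getElem?_range hj, show i₀ + j = i by omega, h1]
        rfl
      · rw [List.getElem?_eq_none (by simpa using hj), List.getElem?_eq_none (by simp; omega)]
    rw [this]
    exact (List.take_prefix _ _).isInfix.trans (List.drop_suffix _ _).isInfix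

/-! ### Darts and their renormalization -/

@[simp] theorem gi_re : gi.re = 0 := rfl
@[simp] theorem gi_im : gi.im = 1 := rfl

/-- An oriented unit segment. -/
@[ext] structure Dart where
  tail : GaussianInt
  dir : GaussianInt
  mem : dir ∈ unitVectors

theorem neg_mem_unitVectors {ε : GaussianInt} (h : ε ∈ unitVectors) : -ε ∈ unitVectors := by
  rcases h with rfl | rfl | rfl | rfl <;> simp [unitVectors]

theorem gi_mul_gi : gi * gi = -1 := by decide

theorem gi_mul_mem_unitVectors {ε : GaussianInt} (h : ε ∈ unitVectors) :
    gi * ε ∈ unitVectors := by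
  rcases h with rfl | rfl | rfl | rfl <;> simp [unitVectors, gi_mul_gi]

theorem sign_mul_mem_unitVectors (a : ℤˣ) {ε : GaussianInt} (h : ε ∈ unitVectors) :
    ((a : ℤ) : GaussianInt) * gi * ε ∈ unitVectors := by
  rcases Int.units_eq_one_or a with rfl | rfl
  · simpa using gi_mul_mem_unitVectors h
  · simpa using neg_mem_unitVectors (gi_mul_mem_unitVectors h)

namespace Dart

/-- The end point of a dart. -/
def head (d : Dart) : GaussianInt := d.tail + d.dir

/-- The dart with the opposite orientation. -/
def flip (d : Dart) : Dart := ⟨d.head, -d.dir, neg_mem_unitVectors d.mem⟩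

/-- Twice the midpoint of a dart. -/
def mid (d : Dart) : GaussianInt := 2 * d.tail + d.dir

@[simp] theorem flip_tail (d : Dart) : d.flip.tail = d.head := rfl
@[simp] theorem flip_dir (d : Dart) : d.flip.dir = -d.dir := rfl
@[simp] theorem flip_head (d : Dart) : d.flip.head = d.tail := by simp [head, flip]
@[simp] theorem flip_flip (d : Dart) : d.flip.flip = d := by
  ext1 <;> simp
@[simp] theorem mid_flip (d : Dart) : d.flip.mid = d.mid := by
  simp only [mid, flip_tail, flip_dir, head]; ring

theorem mid_eq_mid_iff {d e : Dart} : d.mid = e.mid ↔ d = e ∨ d = e.flip := by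
  constructor
  · rcases d with ⟨z, ε, hε⟩
    rcases e with ⟨w, η, hη⟩
    intro h
    have h1 := congrArg Zsqrtd.re h
    have h2 := congrArg Zsqrtd.im h
    simp only [Dart.ext_iff, Zsqrtd.ext_iff, flip, mid, head] at *
    rcases hε with rfl | rfl | rfl | rfl <;> rcases hη with rfl | rfl | rfl | rfl <;>
      simp at h1 h2 ⊢ <;> omega
  · rintro (rfl | rfl) <;> simp

end Dart

/-! ### Vertex states, letters and coarsening -/

/-- `1` for horizontal and `-1` for vertical unit vectors. -/
def axisSign (ε : GaussianInt) : ℤˣ := if ε.im = 0 then 1 else -1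

/-- The turn at the end of a dart when the vertices have the states `s`. The state `1` of a vertex
means that its west and north intervals are connected, and its east and south intervals. -/
def turnAt (s : GaussianInt → ℤˣ) (d : Dart) : ℤˣ := axisSign d.dir * s d.head

/-- The dart following `d` when the vertices have the states `s`. -/
def next (s : GaussianInt → ℤˣ) (d : Dart) : Dart :=
  ⟨d.head, ((turnAt s d : ℤ) : GaussianInt) * gi * d.dir, sign_mul_mem_unitVectors _ d.mem⟩

@[simp] theorem next_tail (s : GaussianInt → ℤˣ) (d : Dart) : (next s d).tail = d.head := rfl

/-- `(-1) ^ n` for an integer `n`. -/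
def paritySign (n : ℤ) : ℤˣ := if n % 2 = 0 then 1 else -1

theorem paritySign_add_one (n : ℤ) : paritySign (n + 1) = -paritySign n := by
  unfold paritySign; split_ifs <;> first | omega | simp

theorem paritySign_add (m n : ℤ) : paritySign (m + n) = paritySign m * paritySign n := by
  unfold paritySign; split_ifs <;> first | omega | simp

/-- The data of one folding level: the class modulo `1 + i` of the vertices which survive, and the
sign of the alternating states at the other vertices. -/
@[ext] structure Letter where
  odd : Bool
  sign : ℤˣ

namespace Letter

variable (l : Letter)

/-- The representative `0` or `1` of the class of surviving vertices. -/
def c : ℤ := if l.odd then 1 else 0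

theorem c_cases : l.c = 0 ∨ l.c = 1 := by unfold c; split_ifs <;> simp

/-- The vertices which survive. -/
def Mem (z : GaussianInt) : Prop := (z.re + z.im) % 2 = l.c

instance (z : GaussianInt) : Decidable (l.Mem z) := inferInstanceAs (Decidable (_ = _))

/-- The sign which alternates on each class of vertices. -/
def tw (z : GaussianInt) : ℤˣ := l.sign * paritySign z.im

/-- The inclusion of the coarser lattice. -/
def lift (z : GaussianInt) : GaussianInt := ⟨l.c + z.re - z.im, z.re + z.im⟩

/-- The inverse of `lift`. -/
def down (z : GaussianInt) : GaussianInt := ⟨(z.re - l.c + z.im) / 2, (z.im - z.re + l.c) / 2⟩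

theorem lift_eq (z : GaussianInt) : l.lift z = l.c + (1 + gi) * z := by
  ext <;> simp [lift] <;> ring

@[simp] theorem down_lift (z : GaussianInt) : l.down (l.lift z) = z := by
  ext <;> simp only [down, lift] <;> omega

theorem lift_down {z : GaussianInt} (h : l.Mem z) : l.lift (l.down z) = z := by
  unfold Mem at h
  ext <;> simp only [down, lift] <;> omega

theorem mem_lift (z : GaussianInt) : l.Mem (l.lift z) := by
  have := l.c_cases
  simp only [Mem, lift]; omega

theorem lift_injective : Function.Injective l.lift :=
  Function.LeftInverse.injective l.down_lift

variable {l}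

theorem mem_add_iff {z ε : GaussianInt} (h : ε ∈ unitVectors) : l.Mem (z + ε) ↔ ¬ l.Mem z := by
  have := l.c_cases
  unfold Mem
  rcases h with rfl | rfl | rfl | rfl <;> simp <;> omega

/-- The factor `axisSign` compensates the change of `paritySign` along a vertical step. Hence the
turn at a vertex with alternating state depends only on the vertex from which the segment starts,
not on its direction. -/
theorem axisSign_mul_tw {ε : GaussianInt} (h : ε ∈ unitVectors) (z : GaussianInt) :
    axisSign ε * l.tw (z + ε) = l.tw z := by
  have h1 : paritySign (z.im + 1) = -paritySign z.im := paritySign_add_one _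
  have h2 : paritySign (z.im + -1) = -paritySign z.im := by
    rw [← neg_inj, ← paritySign_add_one]; simp
  unfold tw
  rcases h with rfl | rfl | rfl | rfl <;> simp [axisSign, h1, h2]

end Letter

theorem Dart.mem_head_iff {l : Letter} {d : Dart} : l.Mem d.head ↔ ¬ l.Mem d.tail :=
  Letter.mem_add_iff d.mem

/-- The direction, in the coordinates of the coarser lattice, of the long segment which starts in
the direction `ε` and turns by the sign `t`. -/
def rot (t : ℤˣ) (ε : GaussianInt) : GaussianInt := if t = 1 then ε else -(gi * ε)

/-- The inverse of `rot`. -/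
def unrot (t : ℤˣ) (ε : GaussianInt) : GaussianInt := if t = 1 then ε else gi * ε

theorem rot_mem (t : ℤˣ) {ε : GaussianInt} (h : ε ∈ unitVectors) : rot t ε ∈ unitVectors := by
  unfold rot; split_ifs
  · exact h
  · exact neg_mem_unitVectors (gi_mul_mem_unitVectors h)

theorem unrot_mem (t : ℤˣ) {ε : GaussianInt} (h : ε ∈ unitVectors) : unrot t ε ∈ unitVectors := by
  unfold unrot; split_ifs
  · exact h
  · exact gi_mul_mem_unitVectors h

theorem gi_mul_gi_mul (ε : GaussianInt) : gi * (gi * ε) = -ε := by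
  rw [← mul_assoc, gi_mul_gi]; simp

@[simp] theorem unrot_rot (t : ℤˣ) (ε : GaussianInt) : unrot t (rot t ε) = ε := by
  unfold rot unrot; split_ifs <;> simp [gi_mul_gi_mul]

@[simp] theorem rot_unrot (t : ℤˣ) (ε : GaussianInt) : rot t (unrot t ε) = ε := by
  unfold rot unrot; split_ifs <;> simp [gi_mul_gi_mul]

namespace Letter

variable (l : Letter)

/-- The long dart with its tail at a surviving vertex which starts with `d`. -/
def coarseFrom (d : Dart) : Dart := ⟨l.down d.tail, rot (l.tw d.tail) d.dir, rot_mem _ d.mem⟩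

/-- The long dart which contains a given dart. -/
def coarse (d : Dart) : Dart :=
  if l.Mem d.tail then l.coarseFrom d else (l.coarseFrom d.flip).flip

/-- The first half of a long dart. -/
def fine (d : Dart) : Dart :=
  ⟨l.lift d.tail, unrot (l.tw (l.lift d.tail)) d.dir, unrot_mem _ d.mem⟩

variable {l}

theorem coarse_of_mem {d : Dart} (h : l.Mem d.tail) : l.coarse d = l.coarseFrom d := if_pos h

theorem coarse_flip (d : Dart) : l.coarse d.flip = (l.coarse d).flip := by
  unfold coarse
  have := Dart.mem_head_iff (l := l) (d := d)
  by_cases h : l.Mem d.tail <;> simp_all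

@[simp] theorem coarse_fine (d : Dart) : l.coarse (l.fine d) = d := by
  rw [coarse_of_mem (by exact l.mem_lift _)]
  ext1 <;> simp [coarseFrom, fine]

theorem fine_coarse {d : Dart} (h : l.Mem d.tail) : l.fine (l.coarse d) = d := by
  rw [coarse_of_mem h]
  ext1 <;> simp [coarseFrom, fine, l.lift_down h]

/-- The states of the surviving vertices, in the coordinates of the coarser lattice. -/
def der (l : Letter) (s : GaussianInt → ℤˣ) (z : GaussianInt) : ℤˣ := l.tw (l.lift z) * s (l.lift z)

/-- The vertices which do not survive have alternating states. -/
def Valid (l : Letter) (s : GaussianInt → ℤˣ) : Prop := ∀ z, ¬ l.Mem z → s z = l.tw z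

variable {s : GaussianInt → ℤˣ}

theorem turnAt_of_mem {d : Dart} (hs : s d.head = l.tw d.head) :
    turnAt s d = l.tw d.tail := by
  rw [turnAt, hs]
  exact axisSign_mul_tw d.mem d.tail

theorem lift_coarse_head {d : Dart} (h : l.Mem d.tail) (hs : s d.head = l.tw d.head) :
    l.lift (l.coarse d).head = (next s d).head := by
  rw [coarse_of_mem h]
  have h1 : l.lift (l.coarseFrom d).head =
      l.lift (l.down d.tail) + (1 + gi) * (rot (l.tw d.tail) d.dir) := by
    simp only [lift_eq, Dart.head, coarseFrom]; ring
  rw [h1, l.lift_down h]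
  simp only [Dart.head, next, turnAt_of_mem hs]
  rcases Int.units_eq_one_or (l.tw d.tail) with ht | ht <;> rw [ht] <;> simp [rot]
  · ring
  · linear_combination -d.dir * gi_mul_gi

/-- Of two consecutive segments one is horizontal and one vertical, so the imaginary part changes by
exactly one. -/
theorem tw_next_head (d : Dart) :
    l.tw (next s d).head = - l.tw d.tail := by
  have h2 := axisSign_mul_tw (l := l) (next s d).mem (next s d).tail
  have h3 := axisSign_mul_tw (l := l) d.mem d.tail
  have h4 : axisSign (next s d).dir = - axisSign d.dir := by
    rcases d with ⟨z, ε, hε⟩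
    simp only [next]
    generalize turnAt s _ = t
    rcases Int.units_eq_one_or t with rfl | rfl <;> rcases hε with rfl | rfl | rfl | rfl <;> decide
  rw [h4] at h2
  change _ * l.tw ((next s d).head) = l.tw d.head at h2
  rw [← h3]
  change _ = - (_ * l.tw d.head)
  rw [← h2, neg_mul, mul_neg, neg_neg, ← mul_assoc, Int.units_mul_self, one_mul]

/-- Seen from its other end, a long segment has the opposite turn in the middle. Its reversed second
half is therefore the first half of the reversed long segment. -/
theorem flip_next_eq_fine {d : Dart} (h : l.Mem d.tail) (hs : s d.head = l.tw d.head) :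
    l.fine (l.coarse d).flip = (next s d).flip := by
  ext1
  · simp only [fine, Dart.flip_tail]
    exact lift_coarse_head h hs
  · simp only [fine, Dart.flip_tail, Dart.flip_dir]
    rw [lift_coarse_head h hs, tw_next_head d, coarse_of_mem h]
    simp only [coarseFrom, next, turnAt_of_mem hs]
    rcases Int.units_eq_one_or (l.tw d.tail) with ht | ht <;> rw [ht] <;> simp [rot, unrot]

/-- The factor `tw` in `der` corrects for the rotation by an eighth of a turn between the two
lattices, so that the long curve turns as the original curve does at the surviving vertices. -/
theorem turnAt_der {d : Dart} (h : l.Mem d.tail) (hs : s d.head = l.tw d.head) :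
    turnAt (l.der s) (l.coarse d) = turnAt s (next s d) := by
  simp only [turnAt, der]
  rw [lift_coarse_head h hs, tw_next_head d, ← mul_assoc]
  congr 1
  rw [coarse_of_mem h]
  simp only [coarseFrom, next, turnAt_of_mem hs]
  generalize l.tw d.tail = t
  have hε := d.mem
  generalize d.dir = ε at hε ⊢
  rcases Int.units_eq_one_or t with rfl | rfl <;> rcases hε with rfl | rfl | rfl | rfl <;> decide

theorem fine_next_coarse {d : Dart} (h : l.Mem d.tail) (hs : s d.head = l.tw d.head) :
    l.fine (next (l.der s) (l.coarse d)) = next s (next s d) := by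
  have hn : l.fine (next (l.der s) (l.coarse d)) =
      ⟨(next s d).head, unrot (-l.tw d.tail) (next (l.der s) (l.coarse d)).dir,
        unrot_mem _ (Dart.mem _)⟩ := by
    ext1
    · simp only [fine, next_tail]
      exact lift_coarse_head h hs
    · simp only [fine, next_tail]
      rw [lift_coarse_head h hs, tw_next_head d]
  rw [hn]
  ext1
  · rfl
  · simp only [next, turnAt_der h hs]
    change unrot _ (((turnAt s (next s d) : ℤ) : GaussianInt) * gi * (l.coarse d).dir) =
      ((turnAt s (next s d) : ℤ) : GaussianInt) * gi *
        (((turnAt s d : ℤ) : GaussianInt) * gi * d.dir)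
    rw [turnAt_of_mem hs, coarse_of_mem h]
    simp only [coarseFrom]
    generalize turnAt s (next s d) = a
    rcases Int.units_eq_one_or (l.tw d.tail) with ht | ht <;> rw [ht] <;> simp [rot, unrot]; ring

theorem coarse_next_of_mem {d : Dart} (h : l.Mem d.tail) (hs : s d.head = l.tw d.head) :
    l.coarse (next s d) = l.coarse d := by
  have := flip_next_eq_fine h hs
  have h2 := congrArg l.coarse this
  rw [coarse_fine, coarse_flip] at h2
  have := congrArg Dart.flip h2
  simpa using this.symm

theorem coarse_next_next {d : Dart} (h : l.Mem d.tail) (hs : s d.head = l.tw d.head) :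
    l.coarse (next s (next s d)) = next (l.der s) (l.coarse d) := by
  rw [← fine_next_coarse h hs, coarse_fine]

end Letter

theorem next_flip_next (s : GaussianInt → ℤˣ) (d : Dart) : next s (next s d).flip = d.flip := by
  ext1
  · simp [Dart.head]
  · simp only [next, turnAt, Dart.flip_dir, Dart.flip_head]
    generalize s d.head = t
    have hε := d.mem
    generalize d.dir = ε at hε ⊢
    rcases Int.units_eq_one_or t with rfl | rfl <;> rcases hε with rfl | rfl | rfl | rfl <;> decide

namespace Letter
variable {l : Letter} {s : GaussianInt → ℤˣ}

/-- Such a `d` is the second half of a long segment, so it is rewritten as `next s e` with `e` the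
first half. -/
theorem coarse_next_of_not_mem (hv : l.Valid s) {d : Dart} (h : ¬ l.Mem d.tail) :
    l.coarse (next s d) = next (l.der s) (l.coarse d) := by
  have hm : l.Mem d.head := Dart.mem_head_iff.2 h
  obtain ⟨e, he⟩ : ∃ e, d = next s e := ⟨(next s d.flip).flip, by
    rw [← Dart.flip_flip (next s _), next_flip_next]; simp⟩
  have hte : l.Mem e.tail := by
    have : d.tail = e.head := by rw [he]; rfl
    rw [this, Dart.mem_head_iff, not_not] at h
    exact h
  have hse := hv e.head (by rw [Dart.mem_head_iff]; simpa using hte)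
  rw [he, coarse_next_next hte hse, coarse_next_of_mem hte hse]

end Letter

/-! ### Connectedness under coarsening -/

/-- Two darts lie, up to orientation, on the same curve when the vertices have the states `s`. -/
def Conn (s : GaussianInt → ℤˣ) : Dart → Dart → Prop :=
  Relation.EqvGen fun d e => e = d.flip ∨ e = next s d

namespace Conn
variable {s : GaussianInt → ℤˣ} {l : Letter}

theorem refl (d : Dart) : Conn s d d := Relation.EqvGen.refl d
theorem symm {d e : Dart} (h : Conn s d e) : Conn s e d := Relation.EqvGen.symm _ _ h
theorem trans {d e f : Dart} (h : Conn s d e) (h' : Conn s e f) : Conn s d f :=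
  Relation.EqvGen.trans _ _ _ h h'
theorem flip (d : Dart) : Conn s d d.flip := Relation.EqvGen.rel _ _ (Or.inl rfl)
theorem next (d : Dart) : Conn s d (PaperFolding.next s d) := Relation.EqvGen.rel _ _ (Or.inr rfl)

theorem of_mid {d e : Dart} (h : d.mid = e.mid) : Conn s d e := by
  rcases Dart.mid_eq_mid_iff.1 h with rfl | rfl
  · exact refl _
  · exact (flip _).symm

theorem coarse (hv : l.Valid s) {d e : Dart} (h : Conn s d e) :
    Conn (l.der s) (l.coarse d) (l.coarse e) := by
  induction h with
  | rel d e h =>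
    rcases h with rfl | rfl
    · rw [Letter.coarse_flip]; exact flip _
    · by_cases h : l.Mem d.tail
      · rw [Letter.coarse_next_of_mem h (hv _ (by rw [Dart.mem_head_iff]; simpa using h))]
        exact refl _
      · rw [Letter.coarse_next_of_not_mem hv h]; exact next _
  | refl d => exact refl _
  | symm d e _ ih => exact ih.symm
  | trans d e f _ _ h1 h2 => exact h1.trans h2

theorem fine (hv : l.Valid s) {d e : Dart} (h : Conn (l.der s) d e) :
    Conn s (l.fine d) (l.fine e) := by
  induction h with
  | rel d e h =>
    have hm : l.Mem (l.fine d).tail := l.mem_lift _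
    have hs := hv (l.fine d).head (by rw [Dart.mem_head_iff]; simpa using hm)
    rcases h with rfl | rfl
    · have := Letter.flip_next_eq_fine hm hs
      rw [Letter.coarse_fine] at this
      rw [this]
      exact (next _).trans (flip _)
    · have := Letter.fine_next_coarse hm hs
      rw [Letter.coarse_fine] at this
      rw [this]
      exact (next _).trans (next _)
  | refl d => exact refl _
  | symm d e _ ih => exact ih.symm
  | trans d e f _ _ h1 h2 => exact h1.trans h2

theorem fine_coarse (hv : l.Valid s) (d : Dart) : Conn s (l.fine (l.coarse d)) d := by
  by_cases h : l.Mem d.tail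
  · rw [Letter.fine_coarse h]; exact refl _
  · have h' : l.Mem d.flip.tail := Dart.mem_head_iff.2 h
    have h1 : Conn s (l.fine (l.coarse d.flip)) d.flip := by
      rw [Letter.fine_coarse h']; exact refl _
    rw [Letter.coarse_flip] at h1
    have h2 : Conn s (l.fine (l.coarse d)) (l.fine (l.coarse d).flip) := fine hv (flip _)
    exact (h2.trans h1).trans (flip d).symm

/-- `fine` inverts `coarse` up to exchanging the two halves of a long segment, and these lie on the
same curve. So the curves of the two levels correspond bijectively. -/
theorem coarse_iff (hv : l.Valid s) {d e : Dart} :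
    Conn (l.der s) (l.coarse d) (l.coarse e) ↔ Conn s d e :=
  ⟨fun h => ((fine_coarse hv d).symm.trans (fine hv h)).trans (fine_coarse hv e), coarse hv⟩

end Conn

/-! ### The action on midpoints -/

/-- The map `coarse` in terms of doubled midpoints. -/
def coarseMidAux (c m : ℤ) (M : GaussianInt) : GaussianInt :=
  if M.re % 2 = 0 then
    -- `M.im` is odd here, so `2 - M.im % 4` is `±1`. The other half of the long segment is
    -- perpendicular, so the doubled midpoint moves by one unit sideways before the division by `1 +
    -- i`.
    let X := M.re - m * (2 - M.im % 4)
    ⟨(X + M.im) / 2 - c, (M.im - X) / 2 + c⟩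
  else
    let Y := M.im + m * (2 - (M.re + 2 * c) % 4)
    ⟨(M.re + Y) / 2 - c, (Y - M.re) / 2 + c⟩

/-- The map `coarse` in terms of doubled midpoints. -/
def Letter.coarseMid (l : Letter) (M : GaussianInt) : GaussianInt := coarseMidAux l.c l.sign M

/-- The doubled midpoints of unit intervals. -/
def IsMid (M : GaussianInt) : Prop := (M.re + M.im) % 2 = 1

theorem Dart.isMid (d : Dart) : IsMid d.mid := by
  rcases d with ⟨z, ε, hε⟩
  unfold IsMid mid
  rcases hε with rfl | rfl | rfl | rfl <;> simp

theorem Letter.mid_coarseFrom (l : Letter) {d : Dart} (h : l.Mem d.tail) :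
    (l.coarseFrom d).mid = l.coarseMid d.mid := by
  rcases d with ⟨⟨x, y⟩, ε, hε⟩
  rcases l with ⟨o, μ⟩
  have hc := Letter.c_cases ⟨o, μ⟩
  simp only [Mem] at h
  generalize hcc : Letter.c ⟨o, μ⟩ = c at *
  simp only [coarseFrom, Dart.mid, coarseMid, coarseMidAux, down, tw, paritySign, hcc]
  rcases Int.units_eq_one_or μ with rfl | rfl <;> rcases hε with rfl | rfl | rfl | rfl <;>
    by_cases hy : y % 2 = 0 <;> simp [rot, hy, Zsqrtd.ext_iff] <;> constructor <;> omega

theorem Letter.mid_coarse (l : Letter) (d : Dart) : (l.coarse d).mid = l.coarseMid d.mid := by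
  by_cases h : l.Mem d.tail
  · rw [coarse_of_mem h, l.mid_coarseFrom h]
  · rw [coarse, if_neg h, Dart.mid_flip, l.mid_coarseFrom (Dart.mem_head_iff.2 h), Dart.mid_flip]

/-! ### Translations -/

theorem units_val_cases (a : ℤˣ) : (a : ℤ) = 1 ∨ (a : ℤ) = -1 := by
  rcases Int.units_eq_one_or a with rfl | rfl <;> simp

namespace Letter

/-- The letter which describes the translate by `-u`. -/
def shift (l : Letter) (u : GaussianInt) : Letter :=
  ⟨decide ((l.c - u.re - u.im) % 2 = 1), l.sign * paritySign u.im⟩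

/-- The translation of the coarser lattice induced by the translation by `u`. -/
def shiftPt (l : Letter) (u : GaussianInt) : GaussianInt :=
  ⟨(u.re - l.c + (l.shift u).c + u.im) / 2, (u.im - u.re + l.c - (l.shift u).c) / 2⟩

variable {l : Letter}

theorem shift_c (l : Letter) (u : GaussianInt) : (l.shift u).c = (l.c - u.re - u.im) % 2 := by
  have : (l.shift u).c = if (l.c - u.re - u.im) % 2 = 1 then 1 else 0 := by
    change (if decide ((l.c - u.re - u.im) % 2 = 1) = true then (1 : ℤ) else 0) = _
    by_cases h : (l.c - u.re - u.im) % 2 = 1 <;> simp [h]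
  rw [this]
  split_ifs <;> omega

theorem shift_mem_iff {u z : GaussianInt} : (l.shift u).Mem z ↔ l.Mem (z + u) := by
  have h1 := l.c_cases
  simp only [Mem, shift_c, Zsqrtd.re_add, Zsqrtd.im_add]
  omega

theorem shift_tw (u z : GaussianInt) : (l.shift u).tw z = l.tw (z + u) := by
  simp [tw, shift, paritySign_add, mul_assoc, mul_comm]

theorem lift_add_shiftPt (u w : GaussianInt) :
    l.lift (w + l.shiftPt u) = (l.shift u).lift w + u := by
  ext <;> simp only [lift, shiftPt, shift_c, Zsqrtd.re_add, Zsqrtd.im_add] <;> omega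

theorem shiftPt_eq_down {u : GaussianInt} (h : l.Mem u) : l.shiftPt u = l.down u := by
  unfold Mem at h
  ext <;> simp only [shiftPt, down, shift_c] <;> omega

theorem shift_c_of_mem {u : GaussianInt} (h : l.Mem u) : (l.shift u).c = 0 := by
  unfold Mem at h
  rw [shift_c]; omega

end Letter

/-- The translate of a dart. -/
def Dart.translate (d : Dart) (u : GaussianInt) : Dart := ⟨d.tail + u, d.dir, d.mem⟩

theorem Dart.flip_translate (d : Dart) (u : GaussianInt) :
    (d.translate u).flip = d.flip.translate u := by
  ext1
  · simp [translate, Dart.head]; ring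
  · rfl

theorem Dart.mid_translate (d : Dart) (u : GaussianInt) :
    (d.translate u).mid = d.mid + 2 * u := by
  simp only [translate, mid]; ring

theorem IsMid.exists_dart {M : GaussianInt} (h : IsMid M) : ∃ d : Dart, d.mid = M := by
  unfold IsMid at h
  by_cases hx : M.re % 2 = 0
  · refine ⟨⟨⟨M.re / 2, (M.im - 1) / 2⟩, gi, by simp [unitVectors]⟩, ?_⟩
    ext <;> simp [Dart.mid] <;> omega
  · refine ⟨⟨⟨(M.re - 1) / 2, M.im / 2⟩, 1, by simp [unitVectors]⟩, ?_⟩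
    ext <;> simp [Dart.mid] <;> omega

namespace Letter

variable {l : Letter}

theorem coarse_translate (d : Dart) (u : GaussianInt) :
    l.coarse (d.translate u) = ((l.shift u).coarse d).translate (l.shiftPt u) := by
  have key : ∀ e : Dart, l.Mem (e.tail + u) →
      l.coarseFrom (e.translate u) = ((l.shift u).coarseFrom e).translate (l.shiftPt u) := by
    intro e he
    ext1
    · apply l.lift_injective
      simp only [coarseFrom, Dart.translate]
      rw [l.lift_down he, lift_add_shiftPt, lift_down _ (shift_mem_iff.2 he)]
    · simp [coarseFrom, Dart.translate, shift_tw]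
  unfold coarse
  by_cases h : l.Mem (d.tail + u)
  · rw [if_pos (by exact h), if_pos (shift_mem_iff.2 h), key d h]
  · rw [if_neg (by exact h), if_neg (by rwa [shift_mem_iff]), Dart.flip_translate, key,
      Dart.flip_translate]
    have := (mem_add_iff (l := l) (z := d.tail + u) d.mem).2 h
    rwa [add_right_comm] at this

/-- A translation passes to the coarser level at the price of a changed letter. This allows
coarsening to be studied near `0` only, where finite computations apply. -/
theorem coarseMid_add {M : GaussianInt} (hM : IsMid M) (u : GaussianInt) :
    l.coarseMid (M + 2 * u) = (l.shift u).coarseMid M + 2 * l.shiftPt u := by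
  obtain ⟨d, rfl⟩ := hM.exists_dart
  rw [← Dart.mid_translate, ← mid_coarse, coarse_translate, Dart.mid_translate, mid_coarse]

end Letter

/-- Steps of `coarseMidAux` contract up to a bounded error. -/
theorem coarseMidAux_spec {c m : ℤ} (hm : m = 1 ∨ m = -1) {M : GaussianInt}
    (hM : IsMid M) : IsMid (coarseMidAux c m M) ∧ ∃ a b : ℤ, |a| + |b| ≤ 1 ∧
      (coarseMidAux c m M).re - (coarseMidAux c m M).im = M.re + a - 2 * c ∧
      (coarseMidAux c m M).re + (coarseMidAux c m M).im = M.im + b := by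
  unfold IsMid at *
  rcases M with ⟨x, y⟩
  simp only at hM
  simp only [coarseMidAux]
  by_cases hx : x % 2 = 0
  · simp only [hx, if_true]
    refine ⟨?_, -(m * (2 - y % 4)), 0, ?_, ?_, ?_⟩ <;> rcases hm with rfl | rfl <;>
      (try simp only [abs_zero, add_zero, abs_le]) <;> omega
  · simp only [hx, if_false]
    refine ⟨?_, 0, m * (2 - (x + 2 * c) % 4), ?_, ?_, ?_⟩ <;> rcases hm with rfl | rfl <;>
      (try simp only [abs_zero, zero_add, abs_le]) <;> omega

/-! ### Compatibility with a stream of letters -/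

/-- The state `x` of the vertex `z` is compatible with the first `n` letters of `τ`. -/
def Compat : (ℕ → Letter) → ℕ → GaussianInt → ℤˣ → Prop
  | _, 0, _, _ => True
  | τ, n + 1, z, x => (¬ (τ 0).Mem z → x = (τ 0).tw z) ∧
      ∀ w, z = (τ 0).lift w → Compat (fun k => τ (k + 1)) n w ((τ 0).tw z * x)

theorem Compat.congr {τ τ' : ℕ → Letter} {n : ℕ} {z : GaussianInt} {x : ℤˣ}
    (h : Compat τ n z x) (hτ : ∀ k < n, τ k = τ' k) : Compat τ' n z x := by
  induction n generalizing τ τ' z x with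
  | zero => trivial
  | succ n ih =>
    rw [Compat, hτ 0 (by omega)] at h
    exact ⟨h.1, fun w hw => ih (h.2 w hw) fun k hk => hτ (k + 1) (by omega)⟩

/-- The stream of letters which describes the translate by `-u`. -/
theorem exists_shift (τ : ℕ → Letter) (u : GaussianInt) : ∃ τ' : ℕ → Letter,
    ∀ n z x, Compat τ n (z + u) x → Compat τ' n z x := by
  -- `p n` is the translation induced by `u` at the level `n`.
  let p : ℕ → GaussianInt := fun n => Nat.rec u (fun k v => (τ k).shiftPt v) n
  refine ⟨fun n => (τ n).shift (p n), fun n => ?_⟩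
  suffices h : ∀ m z x, Compat (fun k => τ (m + k)) n (z + p m) x →
      Compat (fun k => (τ (m + k)).shift (p (m + k))) n z x by
    have h0 := h 0
    simp only [zero_add] at h0
    exact h0
  induction n with
  | zero => intros; trivial
  | succ n ih =>
    intro m z x h
    refine ⟨fun hz => ?_, fun w hw => ?_⟩
    · simp only [add_zero] at hz ⊢
      rw [Letter.shift_tw]
      exact h.1 fun h' => hz (Letter.shift_mem_iff.2 h')
    · have h2 := h.2 (w + p (m + 1)) (by
        simp only [add_zero] at hw ⊢
        rw [hw]
        exact (Letter.lift_add_shiftPt _ _).symm)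
      have h3 := ih (m + 1) w _ (by simpa only [add_assoc, add_comm, add_left_comm] using h2)
      rw [Letter.shift_tw]
      simp only [add_zero] at h3 ⊢
      simpa only [add_assoc, add_comm, add_left_comm] using h3

/-! ### The levels of a folding curve -/

/-- The darts `D k` follow each other when the vertices have the states `s`. -/
def Track (s : GaussianInt → ℤˣ) (D : ℤ → Dart) : Prop := ∀ k, D (k + 1) = next s (D k)

/-- Turns at every second place alternate by `exists_derived`, and so does `tw` by `tw_next_head`. A
letter fitted to the one dart `D q` therefore fits along the whole curve. Nothing is asserted about
vertices off the curve. -/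
theorem Track.exists_letter {s : GaussianInt → ℤˣ} {D : ℤ → Dart} (hD : Track s D)
    (hf : IsCompleteFoldingSeq fun k => turnAt s (D k)) :
    ∃ (l : Letter) (q : ℤ), (∀ j, l.Mem (D (q + 2 * j)).tail) ∧
      (∀ j, s (D (q + 2 * j)).head = l.tw (D (q + 2 * j)).head) ∧
      Track (l.der s) (fun j => l.coarse (D (q + 2 * j))) ∧
      IsCompleteFoldingSeq fun j => turnAt (l.der s) (l.coarse (D (q + 2 * j))) := by
  obtain ⟨q, h1, h2⟩ := hf.exists_derived
  let l : Letter := ⟨decide (((D q).tail.re + (D q).tail.im) % 2 = 1),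
    turnAt s (D q) * paritySign (D q).tail.im⟩
  have hl : l.c = ((D q).tail.re + (D q).tail.im) % 2 := by
    have : l.c = if ((D q).tail.re + (D q).tail.im) % 2 = 1 then 1 else 0 := by
      simp [l, Letter.c]
    rw [this]
    split_ifs <;> omega
  have hstep : ∀ j : ℤ, D (q + 2 * (j + 1)) = next s (next s (D (q + 2 * j))) := by
    intro j
    rw [← hD, ← hD]; congr 1; ring
  have htail : ∀ j : ℤ, (D (q + 2 * (j + 1))).tail = (next s (D (q + 2 * j))).head := by
    intro j; rw [hstep]; rfl
  have hm : ∀ j, l.Mem (D (q + 2 * j)).tail := by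
    have key : ∀ j, l.Mem (D (q + 2 * (j + 1))).tail ↔ l.Mem (D (q + 2 * j)).tail := by
      intro j
      rw [htail, Dart.mem_head_iff, next_tail, Dart.mem_head_iff, not_not]
    intro j
    induction j using Int.induction_on with
    | zero => simp [Letter.Mem, hl]
    | succ j ih => exact (key _).2 ih
    | pred j ih => exact (key _).1 (by simpa using ih)
  have ht : ∀ j, turnAt s (D (q + 2 * j)) = l.tw (D (q + 2 * j)).tail := by
    have key : ∀ j, turnAt s (D (q + 2 * (j + 1))) = l.tw (D (q + 2 * (j + 1))).tail ↔
        turnAt s (D (q + 2 * j)) = l.tw (D (q + 2 * j)).tail := by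
      intro j
      rw [htail, Letter.tw_next_head, h1, neg_inj]
    intro j
    induction j using Int.induction_on with
    | zero => simp [Letter.tw, l, mul_assoc, Int.units_mul_self]
    | succ j ih => exact (key _).2 ih
    | pred j ih => exact (key _).1 (by simpa using ih)
  have hs : ∀ j, s (D (q + 2 * j)).head = l.tw (D (q + 2 * j)).head := by
    intro j
    have := ht j
    rw [turnAt, ← Letter.axisSign_mul_tw (D (q + 2 * j)).mem] at this
    exact mul_left_cancel this
  refine ⟨l, q, hm, hs, fun j => ?_, ?_⟩
  · simp only
    rw [hstep, Letter.coarse_next_next (hm j) (hs j)]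
  · convert h2 using 2 with j
    rw [Letter.turnAt_der (hm j) (hs j), ← hD]

/-- The successive levels of a folding curve. -/
structure Tower where
  letter : ℕ → Letter
  state : ℕ → GaussianInt → ℤˣ
  dart : ℕ → ℤ → Dart
  offset : ℕ → ℤ
  track : ∀ n, Track (state n) (dart n)
  state_succ : ∀ n, state (n + 1) = (letter n).der (state n)
  dart_succ : ∀ n j, dart (n + 1) j = (letter n).coarse (dart n (offset n + 2 * j))
  mem : ∀ n j, (letter n).Mem (dart n (offset n + 2 * j)).tail
  state_head : ∀ n j, state n (dart n (offset n + 2 * j)).head =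
    (letter n).tw (dart n (offset n + 2 * j)).head

theorem exists_tower {s : GaussianInt → ℤˣ} {D : ℤ → Dart} (hD : Track s D)
    (hf : IsCompleteFoldingSeq fun k => turnAt s (D k)) :
    ∃ T : Tower, T.state 0 = s ∧ T.dart 0 = D := by
  let X := {p : (GaussianInt → ℤˣ) × (ℤ → Dart) //
    Track p.1 p.2 ∧ IsCompleteFoldingSeq fun k => turnAt p.1 (p.2 k)}
  have h : ∀ p : X, ∃ (l : Letter) (q : ℤ), (∀ j, l.Mem (p.1.2 (q + 2 * j)).tail) ∧
      (∀ j, p.1.1 (p.1.2 (q + 2 * j)).head = l.tw (p.1.2 (q + 2 * j)).head) ∧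
      Track (l.der p.1.1) (fun j => l.coarse (p.1.2 (q + 2 * j))) ∧
      IsCompleteFoldingSeq fun j => turnAt (l.der p.1.1) (l.coarse (p.1.2 (q + 2 * j))) :=
    fun p => p.2.1.exists_letter p.2.2
  choose l q h1 h2 h3 h4 using h
  let f : X → X := fun p =>
    ⟨((l p).der p.1.1, fun j => (l p).coarse (p.1.2 (q p + 2 * j))), h3 p, h4 p⟩
  let x : ℕ → X := fun n => f^[n] ⟨(s, D), hD, hf⟩
  have hx : ∀ n, x (n + 1) = f (x n) := fun n => Function.iterate_succ_apply' f n _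
  exact ⟨⟨fun n => l (x n), fun n => (x n).1.1, fun n => (x n).1.2, fun n => q (x n),
    fun n => (x n).2.1, fun n => by rw [hx], fun n j => by rw [hx], fun n j => h1 _ j,
    fun n j => h2 _ j⟩, rfl, rfl⟩

namespace Tower

variable (T : Tower)

theorem exists_index (n : ℕ) (k : ℤ) : ∃ j, k = T.offset n + 2 * j ∨ k = T.offset n + 2 * j + 1 :=
  ⟨(k - T.offset n) / 2, by omega⟩

/-- A vertex of the curve is either the middle of a long segment, where the letter prescribes its
state, or the end of one, and then it is a vertex of the curve of the next level. -/
theorem compat (m n : ℕ) (k : ℤ) : Compat (fun i => T.letter (n + i)) m (T.dart n k).head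
    (T.state n (T.dart n k).head) := by
  induction m generalizing n k with
  | zero => trivial
  | succ m ih =>
    obtain ⟨j, rfl | rfl⟩ := T.exists_index n k
    · refine ⟨fun _ => T.state_head n j, fun w hw => ?_⟩
      have h1 := Letter.mem_lift (T.letter n) w
      simp only [add_zero] at hw
      rw [← hw, Dart.mem_head_iff] at h1
      exact absurd (T.mem n j) h1
    · have hd : (T.dart n (T.offset n + 2 * j + 1)).head =
          (T.letter n).lift (T.dart (n + 1) j).head := by
        rw [T.track n, T.dart_succ, Letter.lift_coarse_head (T.mem n j) (T.state_head n j)]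
      rw [hd]
      refine ⟨fun h => absurd (Letter.mem_lift _ _) h, fun w hw => ?_⟩
      obtain rfl := Letter.lift_injective _ hw
      have := ih (n + 1) j
      rw [T.state_succ, Letter.der] at this
      simpa only [add_assoc, add_comm 1, add_zero] using this

/-- The doubled midpoints of the darts of a level. -/
def Covers (n : ℕ) (M : GaussianInt) : Prop := ∃ k, (T.dart n k).mid = M

theorem covers_of_coarseMid {n : ℕ} {d : Dart}
    (h : T.Covers (n + 1) ((T.letter n).coarseMid d.mid)) :
    T.Covers n d.mid := by
  wlog hd : (T.letter n).Mem d.tail generalizing d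
  · have := this (d := d.flip) (by simpa using h) (Dart.mem_head_iff.2 hd)
    simpa using this
  obtain ⟨j, hj⟩ := h
  have hm := T.mem n j
  have hs := T.state_head n j
  rw [T.dart_succ, ← Letter.mid_coarse] at hj
  rcases Dart.mid_eq_mid_iff.1 hj.symm with h | h
  · have := congrArg (T.letter n).fine h
    rw [Letter.fine_coarse hd, Letter.fine_coarse hm] at this
    exact ⟨_, by rw [this]⟩
  · have := congrArg (T.letter n).fine h
    rw [Letter.fine_coarse hd, Letter.flip_next_eq_fine hm hs, ← T.track n] at this
    exact ⟨_, by rw [this, Dart.mid_flip]⟩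

end Tower

/-- Iterated coarsening around a vertex which survives at all levels. -/
def centralMid : (ℕ → ℤˣ) → ℕ → GaussianInt → GaussianInt
  | _, 0, M => M
  | μ, n + 1, M => centralMid (fun k => μ (k + 1)) n (coarseMidAux 0 (μ 0) M)

theorem IsMid.add_two_mul {M : GaussianInt} (h : IsMid M) (u : GaussianInt) :
    IsMid (M + 2 * u) := by
  unfold IsMid at *
  simp; omega

/-- The vertex `z` of the last level is lifted down to level `m`. Relative to its lifts every
coarsening fixes the origin, so only the signs of the letters matter. -/
theorem Tower.covers_of_centralMid (T : Tower) (N m : ℕ) (z : GaussianInt) :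
    ∃ (μ : ℕ → ℤˣ) (u : GaussianInt), ∀ M, IsMid M →
      T.Covers (m + N) (centralMid μ N M + 2 * z) → T.Covers m (M + 2 * u) := by
  induction N generalizing m with
  | zero => exact ⟨fun _ => 1, z, fun M _ h => h⟩
  | succ N ih =>
    obtain ⟨μ, u, h⟩ := ih (m + 1)
    have hu := (T.letter m).mem_lift u
    refine ⟨fun k => Nat.casesOn k ((T.letter m).tw ((T.letter m).lift u)) μ,
      (T.letter m).lift u, fun M hM hc => ?_⟩
    obtain ⟨d, hd⟩ := (hM.add_two_mul ((T.letter m).lift u)).exists_dart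
    rw [← hd]
    apply T.covers_of_coarseMid
    rw [hd, Letter.coarseMid_add hM, Letter.shiftPt_eq_down hu, Letter.down_lift, Letter.coarseMid,
      Letter.shift_c_of_mem hu]
    apply h _ (coarseMidAux_spec (units_val_cases _) hM).1
    rw [add_right_comm m 1 N]
    exact hc

/-! ### A folding curve covers large boxes -/

/-- The iterated map `centralMid` for a finite list of signs. -/
def centralMidList (w : List ℤ) (M : GaussianInt) : GaussianInt :=
  w.foldl (fun M m => coarseMidAux 0 m M) M

/-- All lists of `n` signs. -/
def signLists : ℕ → List (List ℤ)
  | 0 => [[]]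
  | n + 1 => (signLists n).flatMap fun w => [1 :: w, -1 :: w]

/-- The doubled midpoints of the `12` intervals of the box of side `2` around `0`. -/
def boxMids : List GaussianInt :=
  [⟨-2, -1⟩, ⟨-2, 1⟩, ⟨-1, -2⟩, ⟨-1, 0⟩, ⟨-1, 2⟩, ⟨0, -1⟩, ⟨0, 1⟩, ⟨1, -2⟩, ⟨1, 0⟩, ⟨1, 2⟩,
    ⟨2, -1⟩, ⟨2, 1⟩]

/-- Centres of boxes which between them serve for all signs of seven levels. -/
def boxCentres : List GaussianInt :=
  [⟨2, -6⟩, ⟨6, -2⟩, ⟨2, -4⟩, ⟨6, -4⟩, ⟨2, -2⟩, ⟨6, -6⟩, ⟨4, -8⟩, ⟨4, 0⟩, ⟨-2, -6⟩, ⟨10, -2⟩,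
    ⟨2, -8⟩, ⟨6, 0⟩, ⟨4, -6⟩, ⟨9, -4⟩]

/-- For each of the `128` sign words some box of side `2` collapses entirely, in seven coarsenings,
to the interval `[0, 1]`, whose doubled midpoint is `1`. -/
theorem exists_boxCentre : (signLists 7).all (fun w => boxCentres.any fun q =>
    boxMids.all fun M => decide (centralMidList w (M + 2 * q) = 1)) = true := by
  decide +kernel

theorem mem_signLists (w : List ℤ) (hw : ∀ m ∈ w, m = 1 ∨ m = -1) : w ∈ signLists w.length := by
  induction w with
  | nil => simp [signLists]
  | cons m w ih =>
    simp only [List.length_cons, signLists, List.mem_flatMap]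
    refine ⟨w, ih fun m hm => hw m (by simp [hm]), ?_⟩
    rcases hw m (by simp) with rfl | rfl <;> simp

theorem mem_boxMids {M : GaussianInt} (hM : IsMid M) (h1 : |M.re| ≤ 2) (h2 : |M.im| ≤ 2) :
    M ∈ boxMids := by
  rcases M with ⟨x, y⟩
  simp only [abs_le, IsMid] at h1 h2 hM
  obtain ⟨h1, h1'⟩ := h1
  obtain ⟨h2, h2'⟩ := h2
  interval_cases x <;> interval_cases y <;> first | omega | decide

/-- Boxes of any size are absorbed by one interval: two coarsenings roughly halve a box, and the
computed boxes start the induction. -/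
theorem exists_central_box (R : ℕ) : ∃ N, ∀ μ : ℕ → ℤˣ, ∃ q : GaussianInt, ∀ M, IsMid M →
    |M.re - 2 * q.re| ≤ R + 2 → |M.im - 2 * q.im| ≤ R + 2 → centralMid μ N M = 1 := by
  induction R with
  | zero =>
    refine ⟨7, fun μ => ?_⟩
    have h := exists_boxCentre
    rw [List.all_eq_true] at h
    have h := h _ (mem_signLists [(μ 0 : ℤ), μ 1, μ 2, μ 3, μ 4, μ 5, μ 6]
      (by simp [Int.units_eq_one_or]))
    rw [List.any_eq_true] at h
    obtain ⟨q, -, h⟩ := h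
    rw [List.all_eq_true] at h
    refine ⟨q, fun M hM h1 h2 => ?_⟩
    have h3 := h (M - 2 * q) (mem_boxMids (by unfold IsMid at *; simp; omega)
      (by simpa using h1) (by simpa using h2))
    rw [decide_eq_true_eq, sub_add_cancel] at h3
    exact h3
  | succ R ih =>
    obtain ⟨N, h⟩ := ih
    refine ⟨N + 2, fun μ => ?_⟩
    obtain ⟨q, h⟩ := h fun k => μ (k + 2)
    -- Two coarsenings divide by `(1 + i) ^ 2 = 2 * i`, so the new centre is `2 * i * q`. The
    -- accumulated error is at most `2`, and `R + 5 ≤ 2 * (R + 2) + 1` suffices for integers.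
    refine ⟨⟨-2 * q.im, 2 * q.re⟩, fun M hM h1 h2 => ?_⟩
    obtain ⟨hM1, a, b, hab, h3, h4⟩ := coarseMidAux_spec (c := 0) (units_val_cases (μ 0)) hM
    obtain ⟨hM2, a', b', hab', h5, h6⟩ := coarseMidAux_spec (c := 0) (units_val_cases (μ 1)) hM1
    have key := h _ hM2
    simp only [abs_le] at h1 h2 key
    have e1 := abs_nonneg a
    have e2 := abs_nonneg b
    have e3 := abs_nonneg a'
    have e4 := abs_nonneg b'
    have f1 := le_abs_self a
    have f2 := neg_abs_le a
    have f3 := le_abs_self b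
    have f4 := neg_abs_le b
    have f5 := le_abs_self a'
    have f6 := neg_abs_le a'
    have f7 := le_abs_self b'
    have f8 := neg_abs_le b'
    push_cast at *
    exact key ⟨by omega, by omega⟩ ⟨by omega, by omega⟩

/-- Boxes were made to collapse onto the horizontal interval `[0, 1]`. A curve has horizontal
segments at every level because each turn exchanges the two axes. -/
theorem Tower.exists_horizontal (T : Tower) (n : ℕ) : ∃ z, T.Covers n (1 + 2 * z) := by
  suffices h : ∃ k, (T.dart n k).mid.re % 2 = 1 by
    obtain ⟨k, hk⟩ := h
    have := (T.dart n k).isMid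
    unfold IsMid at this
    refine ⟨⟨((T.dart n k).mid.re - 1) / 2, (T.dart n k).mid.im / 2⟩, k, ?_⟩
    ext <;> simp <;> omega
  by_cases h : (T.dart n 0).mid.re % 2 = 1
  · exact ⟨0, h⟩
  · refine ⟨0 + 1, ?_⟩
    rw [T.track]
    generalize T.dart n 0 = d at *
    rcases d with ⟨z, ε, hε⟩
    simp only [next, Dart.mid] at *
    generalize turnAt _ _ = t
    rcases hε with rfl | rfl | rfl | rfl <;> simp at h <;>
      rcases Int.units_eq_one_or t with rfl | rfl <;> simp

/-- A folding curve covers arbitrarily large boxes. -/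
theorem Tower.exists_box (T : Tower) (R : ℕ) : ∃ q : GaussianInt, ∀ M, IsMid M →
    |M.re - 2 * q.re| ≤ R → |M.im - 2 * q.im| ≤ R → T.Covers 0 M := by
  obtain ⟨N, h⟩ := exists_central_box R
  obtain ⟨z, hz⟩ := T.exists_horizontal (0 + N)
  obtain ⟨μ, u, hu⟩ := T.covers_of_centralMid N 0 z
  obtain ⟨q, hq⟩ := h μ
  refine ⟨q + u, fun M hM h1 h2 => ?_⟩
  have := hu (M - 2 * u) (by unfold IsMid at *; simp; omega) (by
    rw [hq (M - 2 * u) (by unfold IsMid at *; simp; omega)]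
    · exact hz
    · simp only [abs_le] at *; simp at *; omega
    · simp only [abs_le] at *; simp at *; omega)
  simpa using this

/-! ### The states of a covering -/

/-- The support of a dart. -/
def Dart.edge (d : Dart) : Sym2 GaussianInt := s(d.tail, d.head)

theorem Dart.edge_eq_edge_iff {d e : Dart} : d.edge = e.edge ↔ d = e ∨ d = e.flip := by
  constructor
  · intro h
    rcases Sym2.eq_iff.1 h with ⟨h1, h2⟩ | ⟨h1, h2⟩
    · left
      ext1
      · exact h1
      · simpa [Dart.head, h1] using h2
    · right
      ext1
      · exact h1
      · simp only [flip_dir]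
        simp only [Dart.head] at h1 h2
        rw [h1] at h2
        linear_combination h2
  · rintro (rfl | rfl)
    · rfl
    · simp [edge, Sym2.eq_swap]

theorem Dart.edge_flip (d : Dart) : d.flip.edge = d.edge := by simp [edge, Sym2.eq_swap]

theorem Dart.isUnitInterval_edge (d : Dart) : IsUnitInterval d.edge := by
  rcases d with ⟨z, ε, hε⟩
  rcases hε with rfl | rfl | rfl | rfl
  · exact ⟨z, Or.inl rfl⟩
  · exact ⟨z + -1, Or.inl (by simp [edge, head, Sym2.eq_swap])⟩
  · exact ⟨z, Or.inr rfl⟩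
  · exact ⟨z + -gi, Or.inr (by simp [edge, head, Sym2.eq_swap])⟩

theorem Dart.dir_ne_zero (d : Dart) : d.dir ≠ 0 := by
  rcases d.mem with h | h | h | h <;> rw [h] <;> decide

theorem Dart.flip_ne (d : Dart) : d.flip ≠ d := by
  intro h
  have := congrArg Dart.tail h
  simp only [flip_tail, head] at this
  exact d.dir_ne_zero (by simpa using this)

/-- The oriented segments of a curve. -/
def CompleteCurve.dart (c : CompleteCurve) (k : ℤ) : Dart := ⟨c.pt k, c.dir k, c.dir_mem k⟩

theorem CompleteCurve.dart_succ_tail (c : CompleteCurve) (k : ℤ) :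
    (c.dart (k + 1)).tail = (c.dart k).head := c.pt_succ k

theorem CompleteCurve.support_eq (c : CompleteCurve) (k : ℤ) : c.support k = (c.dart k).edge := rfl

/-- Up to orientation, a curve of `C` passes from `d` to `e`. -/
def Follow (C : Set CompleteCurve) (d e : Dart) : Prop :=
  ∃ c ∈ C, ∃ k : ℤ, (c.dart k = d ∧ c.dart (k + 1) = e) ∨
    (c.dart k = e.flip ∧ c.dart (k + 1) = d.flip)

theorem Follow.flip {C : Set CompleteCurve} {d e : Dart} (h : Follow C d e) :
    Follow C e.flip d.flip := by
  obtain ⟨c, hc, k, h⟩ := h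
  exact ⟨c, hc, k, by simpa using h.symm⟩

section Covering

variable {C : Set CompleteCurve}

theorem IsCovering.exists_dart (hC : IsCovering C) (d : Dart) :
    ∃ c ∈ C, ∃ k : ℤ, c.dart k = d ∨ c.dart k = d.flip := by
  obtain ⟨⟨c, k⟩, ⟨h1, h2⟩, -⟩ := hC d.edge d.isUnitInterval_edge
  exact ⟨c, h1, k, Dart.edge_eq_edge_iff.1 h2⟩

theorem IsCovering.unique (hC : IsCovering C) {c c' : CompleteCurve} (h : c ∈ C) (h' : c' ∈ C)
    {k k' : ℤ} (he : (c.dart k).edge = (c'.dart k').edge) : c = c' ∧ k = k' := by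
  have := (hC (c.dart k).edge (Dart.isUnitInterval_edge _)).unique
    (y₁ := (c, k)) (y₂ := (c', k')) ⟨h, rfl⟩ ⟨h', he.symm⟩
  exact Prod.ext_iff.1 this

theorem IsCovering.exists_follow (hC : IsCovering C) (d : Dart) :
    ∃ e, Follow C d e ∧ e.tail = d.head ∧
      ∃ t : ℤˣ, e.dir = ((t : ℤ) : GaussianInt) * gi * d.dir := by
  obtain ⟨c, hc, k, rfl | h⟩ := hC.exists_dart d
  · exact ⟨c.dart (k + 1), ⟨c, hc, k, Or.inl ⟨rfl, rfl⟩⟩, c.pt_succ k, c.turn k, c.dir_succ k⟩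
  · obtain ⟨k, rfl⟩ : ∃ j, k = j + 1 := ⟨k - 1, by ring⟩
    refine ⟨(c.dart k).flip, ⟨c, hc, k, Or.inr ⟨by simp, h⟩⟩, ?_, -c.turn k, ?_⟩
    · rw [Dart.flip_tail, ← c.dart_succ_tail, h, Dart.flip_tail]
    · have h1 : -d.dir = ((c.turn k : ℤ) : GaussianInt) * gi * c.dir k := by
        rw [← c.dir_succ]; exact (congrArg Dart.dir h).symm
      change -c.dir k = _
      rcases Int.units_eq_one_or (c.turn k) with ht | ht <;> rw [ht] at h1 ⊢ <;>
        simp only [Units.val_one, Units.val_neg, Int.cast_one, Int.cast_neg, neg_neg] at h1 ⊢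
      · linear_combination -gi * h1 - c.dir k * gi_mul_gi
      · linear_combination gi * h1 - c.dir k * gi_mul_gi

theorem IsCovering.follow_unique (hC : IsCovering C) {d e e' : Dart} (h : Follow C d e)
    (h' : Follow C d e') : e = e' := by
  obtain ⟨c, hc, k, ⟨h1, h2⟩ | ⟨h1, h2⟩⟩ := h <;> obtain ⟨c', hc', k', ⟨h3, h4⟩ | ⟨h3, h4⟩⟩ := h'
  · obtain ⟨rfl, rfl⟩ := hC.unique (k := k) (k' := k') hc hc' (by rw [h1, h3])
    exact h2.symm.trans h4
  · obtain ⟨rfl, rfl⟩ := hC.unique (k := k) (k' := k' + 1) hc hc' (by rw [h1, h4, Dart.edge_flip])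
    exact absurd (h4.symm.trans h1) (Dart.flip_ne d)
  · obtain ⟨rfl, h⟩ := hC.unique (k := k + 1) (k' := k') hc hc' (by rw [h2, h3, Dart.edge_flip])
    rw [h, h3] at h2
    exact absurd h2.symm (Dart.flip_ne d)
  · obtain ⟨rfl, h⟩ := hC.unique (k := k + 1) (k' := k' + 1) hc hc' (by rw [h2, h4])
    have hk : k = k' := by omega
    rw [hk] at h1
    have := congrArg Dart.flip (h1.symm.trans h3)
    simpa using this

open Classical in
/-- The state of a vertex: `1` if the west and north intervals are connected. -/
noncomputable def vertexState (C : Set CompleteCurve) (z : GaussianInt) : ℤˣ :=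
  if Consecutive C s(z - 1, z) s(z, z + gi) then 1 else -1

/-- The hypotheses leave `d.head` as the only common endpoint of the two intervals, so the
unoriented relation determines how they are passed. -/
theorem consecutive_iff_follow {d e : Dart} (h1 : e.tail = d.head) (h2 : d.tail ≠ e.tail)
    (h3 : e.head ≠ d.head) (h4 : d.tail ≠ e.head) :
    Consecutive C d.edge e.edge ↔ Follow C d e := by
  constructor
  · rintro ⟨c, hc, k, h⟩
    refine ⟨c, hc, k, ?_⟩
    simp only [CompleteCurve.support_eq, Dart.edge_eq_edge_iff] at h
    have ht := c.dart_succ_tail k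
    rcases h with ⟨h | h, h' | h'⟩ | ⟨h | h, h' | h'⟩ <;> rw [h, h'] at ht <;> simp_all
  · rintro ⟨c, hc, k, ⟨h, h'⟩ | ⟨h, h'⟩⟩
    · exact ⟨c, hc, k, Or.inl (by simp [CompleteCurve.support_eq, h, h'])⟩
    · exact ⟨c, hc, k, Or.inr (by simp [CompleteCurve.support_eq, h, h', Dart.edge_flip])⟩

/-- The dart which ends at `z` with direction `ε`. -/
def dartTo (z ε : GaussianInt) (h : ε ∈ unitVectors) : Dart := ⟨z - ε, ε, h⟩

theorem one_mem : (1 : GaussianInt) ∈ unitVectors := by simp [unitVectors]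
theorem gi_mem : gi ∈ unitVectors := by simp [unitVectors]
theorem neg_one_mem : (-1 : GaussianInt) ∈ unitVectors := by simp [unitVectors]
theorem neg_gi_mem : -gi ∈ unitVectors := by simp [unitVectors]

theorem vertexState_eq_one_iff (z : GaussianInt) :
    vertexState C z = 1 ↔ Follow C (dartTo z 1 one_mem) ⟨z, gi, gi_mem⟩ := by
  rw [← consecutive_iff_follow]
  · have h : (-1 : ℤˣ) ≠ 1 := by decide
    simp [vertexState, Dart.edge, dartTo, Dart.head, h]
  · simp [dartTo, Dart.head]
  · simp [dartTo]
  · simp [dartTo, Dart.head, Zsqrtd.ext_iff]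
  · simp [dartTo, Dart.head, Zsqrtd.ext_iff]

theorem IsCovering.follow_cases (hC : IsCovering C) (z ε : GaussianInt) (h : ε ∈ unitVectors) :
    Follow C (dartTo z ε h) ⟨z, gi * ε, gi_mul_mem_unitVectors h⟩ ∨
    Follow C (dartTo z ε h) ⟨z, -(gi * ε), neg_mem_unitVectors (gi_mul_mem_unitVectors h)⟩ := by
  obtain ⟨⟨w, η, hη⟩, h1, h2, t, h3⟩ := hC.exists_follow (dartTo z ε h)
  have hw : w = z := by simpa [dartTo, Dart.head] using h2
  subst hw
  rcases Int.units_eq_one_or t with rfl | rfl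
  · left
    have : η = gi * ε := by simpa [dartTo] using h3
    subst this
    exact h1
  · right
    have : η = -(gi * ε) := by simpa [dartTo] using h3
    subst this
    exact h1

/-- Every turn joins a horizontal interval to a vertical one. Once the partner of the west interval
is known, uniqueness of successors forces the other pair, so one sign describes the vertex. -/
theorem IsCovering.follow_next (hC : IsCovering C) (d : Dart) :
    Follow C d (next (vertexState C) d) := by
  obtain ⟨z, ε, hε, rfl⟩ : ∃ z ε hε, d = dartTo z ε hε :=
    ⟨d.head, d.dir, d.mem, by ext1 <;> simp [dartTo, Dart.head]⟩
  -- the dart from `z` in the direction `η`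
  let out : (η : GaussianInt) → η ∈ unitVectors → Dart := fun η hη => ⟨z, η, hη⟩
  have hflip : ∀ ε η hε hη, Follow C (dartTo z ε hε) (out η hη) →
      Follow C (dartTo z (-η) (neg_mem_unitVectors hη)) (out (-ε) (neg_mem_unitVectors hε)) := by
    intro ε η hε hη h
    convert h.flip using 1
    · ext1 <;> simp [dartTo, out, Dart.head]
    · ext1 <;> simp [dartTo, out, Dart.head]
  have hout : ∀ ε hε, next (vertexState C) (dartTo z ε hε) =
      out (((axisSign ε * vertexState C z : ℤˣ) : ℤ) * gi * ε) (sign_mul_mem_unitVectors _ hε) := by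
    intro ε hε
    ext1 <;> simp [next, dartTo, out, Dart.head, turnAt]
  have hne : ∀ ε η η' hε hη hη', η ≠ η' → Follow C (dartTo z ε hε) (out η hη) →
      ¬ Follow C (dartTo z ε hε) (out η' hη') := by
    intro ε η η' hε hη hη' hn h h'
    exact hn (congrArg Dart.dir (hC.follow_unique h h'))
  have hcong : ∀ ε ε' η η' hε hε' hη hη', ε = ε' → η = η' →
      Follow C (dartTo z ε hε) (out η hη) → Follow C (dartTo z ε' hε') (out η' hη') := by
    rintro ε _ η _ _ _ _ _ rfl rfl h; exact h
  have hW := hC.follow_cases z 1 one_mem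
  have hE := hC.follow_cases z (-1) neg_one_mem
  have h1 := vertexState_eq_one_iff (C := C) z
  rw [hout]
  rcases Int.units_eq_one_or (vertexState C z) with hs | hs <;> rw [hs]
  · have hWN : Follow C (dartTo z 1 one_mem) (out gi gi_mem) := h1.1 hs
    have hNW := hflip _ _ _ _ hWN
    have hES : Follow C (dartTo z (-1) neg_one_mem) (out (-gi) neg_gi_mem) := by
      rcases hE with h | h
      · exact hcong _ _ _ _ _ _ _ _ rfl (by simp) h
      · have := hcong _ (-1) _ gi _ neg_one_mem _ gi_mem rfl (by simp) h
        have := hflip _ _ _ _ this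
        exact absurd this (hne _ _ _ _ _ _ (by decide) hNW)
    have hSE := hflip _ _ _ _ hES
    rcases hε with rfl | rfl | rfl | rfl
    · exact hcong _ _ _ _ _ _ _ _ rfl (by decide) hWN
    · exact hcong _ _ _ _ _ _ _ _ rfl (by decide) hES
    · exact hcong _ _ _ _ _ _ _ _ (by decide) (by decide) hSE
    · exact hcong _ _ _ _ _ _ _ _ rfl (by decide) hNW
  · have hWS : Follow C (dartTo z 1 one_mem) (out (-gi) neg_gi_mem) := by
      rcases hW with h | h
      · have : vertexState C z = 1 := h1.2 (hcong _ _ _ _ _ _ _ _ rfl (by simp) h)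
        rw [hs] at this
        exact absurd this (by decide)
      · exact hcong _ _ _ _ _ _ _ _ rfl (by simp) h
    have hSW := hflip _ _ _ _ hWS
    have hEN : Follow C (dartTo z (-1) neg_one_mem) (out gi gi_mem) := by
      rcases hE with h | h
      · have := hcong _ (-1) _ (-gi) _ neg_one_mem _ neg_gi_mem rfl (by simp) h
        have := hflip _ _ _ _ this
        exact absurd this (hne _ _ _ _ _ _ (by decide) hSW)
      · exact hcong _ _ _ _ _ _ _ _ rfl (by simp) h
    have hNE := hflip _ _ _ _ hEN
    rcases hε with rfl | rfl | rfl | rfl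
    · exact hcong _ _ _ _ _ _ _ _ rfl (by decide) hWS
    · exact hcong _ _ _ _ _ _ _ _ rfl (by decide) hEN
    · exact hcong _ _ _ _ _ _ _ _ (by decide) (by decide) hSW
    · exact hcong _ _ _ _ _ _ _ _ rfl (by decide) hNE

theorem IsCovering.track (hC : IsCovering C) {c : CompleteCurve} (hc : c ∈ C) :
    Track (vertexState C) c.dart := fun k =>
  hC.follow_unique ⟨c, hc, k, Or.inl ⟨rfl, rfl⟩⟩ (hC.follow_next _)

theorem IsCovering.turnAt_dart (hC : IsCovering C) {c : CompleteCurve} (hc : c ∈ C) (k : ℤ) :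
    turnAt (vertexState C) (c.dart k) = c.turn k := by
  have h1 := congrArg Dart.dir (hC.track hc k)
  have h2 := c.dir_succ k
  change c.dir (k + 1) = _ * gi * c.dir k at h1
  rw [h1] at h2
  have h3 := mul_right_cancel₀ (by decide) (mul_right_cancel₀ (c.dart k).dir_ne_zero h2)
  exact Units.ext (by exact_mod_cast h3)

/-- The dart `d` lies, up to orientation, on the curve `c`. -/
def CompleteCurve.Contains (c : CompleteCurve) (d : Dart) : Prop :=
  ∃ k, c.dart k = d ∨ c.dart k = d.flip

theorem CompleteCurve.contains_flip {c : CompleteCurve} {d : Dart} :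
    c.Contains d.flip ↔ c.Contains d := by
  simp [Contains, or_comm]

theorem IsCovering.contains_next (hC : IsCovering C) {c : CompleteCurve} (hc : c ∈ C) {d : Dart}
    (h : c.Contains d) : c.Contains (next (vertexState C) d) := by
  obtain ⟨k, rfl | h⟩ := h
  · exact ⟨k + 1, Or.inl (hC.track hc k)⟩
  · refine ⟨k - 1, Or.inr ?_⟩
    have h1 := hC.track hc (k - 1)
    rw [sub_add_cancel, h] at h1
    have h2 := congrArg Dart.flip h1
    rw [Dart.flip_flip] at h2
    rw [h2, next_flip_next, Dart.flip_flip]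

theorem IsCovering.contains_iff_of_conn (hC : IsCovering C) {c : CompleteCurve} (hc : c ∈ C)
    {d e : Dart} (h : Conn (vertexState C) d e) : c.Contains d ↔ c.Contains e := by
  induction h with
  | rel d e h =>
    rcases h with rfl | rfl
    · exact CompleteCurve.contains_flip.symm
    · refine ⟨hC.contains_next hc, fun h => ?_⟩
      have := hC.contains_next hc (CompleteCurve.contains_flip.2 h)
      rw [next_flip_next] at this
      exact CompleteCurve.contains_flip.1 this
  | refl d => rfl
  | symm d e _ ih => exact ih.symm
  | trans d e f _ _ h1 h2 => exact h1.trans h2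

theorem IsCovering.eq_of_contains (hC : IsCovering C) {c c' : CompleteCurve} (hc : c ∈ C)
    (hc' : c' ∈ C) {d : Dart} (h : c.Contains d) (h' : c'.Contains d) : c = c' := by
  obtain ⟨k, hk⟩ := h
  obtain ⟨k', hk'⟩ := h'
  exact (hC.unique hc hc' (k := k) (k' := k')
    ((Dart.edge_eq_edge_iff.2 hk).trans (Dart.edge_eq_edge_iff.2 hk').symm)).1

theorem IsCovering.conn_of_contains (hC : IsCovering C) {c : CompleteCurve} (hc : c ∈ C)
    {d e : Dart} (h : c.Contains d) (h' : c.Contains e) : Conn (vertexState C) d e := by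
  have key : ∀ k, Conn (vertexState C) (c.dart 0) (c.dart k) := by
    intro k
    induction k using Int.induction_on with
    | zero => exact Conn.refl _
    | succ k ih => rw [hC.track hc]; exact ih.trans (Conn.next _)
    | pred k ih =>
      have := hC.track hc (-(k : ℤ) - 1)
      rw [sub_add_cancel] at this
      rw [this] at ih
      exact ih.trans (Conn.next _).symm
  have key' : ∀ d, c.Contains d → Conn (vertexState C) (c.dart 0) d := by
    rintro d ⟨k, rfl | h⟩
    · exact key k
    · exact (h ▸ key k).trans (Conn.flip d).symm
  exact (key' d h).symm.trans (key' e h')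

/-! ### The letters of a covering with the local isomorphism property -/

theorem abs_le_of_norm_le {w : GaussianInt} {r : ℕ} (h : Zsqrtd.norm w ≤ (r : ℤ) ^ 2) :
    |w.re| ≤ r ∧ |w.im| ≤ r := by
  rw [Zsqrtd.norm_def] at h
  constructor <;> apply abs_le_of_sq_le_sq _ (by positivity) <;>
    nlinarith [sq_nonneg w.re, sq_nonneg w.im]

/-- The west and north intervals of the vertices in `W` determine their states. Local isomorphism
places a copy of them inside a box covered by one curve, whose letters, translated back, fit the
window. -/
theorem exists_letters_window (hC : IsCovering C) (hf : ∀ c ∈ C, c.IsFolding)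
    (hlip : LocalIsomorphismProperty C) (W : Finset GaussianInt) :
    ∃ τ : ℕ → Letter, ∀ z ∈ W, ∀ n, Compat τ n z (vertexState C z) := by
  classical
  obtain ⟨c, hc, -⟩ := hC.exists_dart ⟨0, 1, one_mem⟩
  obtain ⟨T, hT0, hT1⟩ := exists_tower (hC.track hc) (by
    simp only [hC.turnAt_dart hc]; exact hf c hc)
  obtain ⟨r, hr⟩ := hlip (W.biUnion fun z => {s(z - 1, z), s(z, z + gi)}) (by
    intro e he
    simp only [Finset.mem_biUnion, Finset.mem_insert, Finset.mem_singleton] at he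
    obtain ⟨z, -, rfl | rfl⟩ := he
    · exact ⟨z - 1, Or.inl (by simp)⟩
    · exact ⟨z, Or.inr rfl⟩)
  -- Doubled midpoints double the radius `r`, and the midpoint of a west interval is one further
  -- unit away from the doubled vertex.
  obtain ⟨q, hq⟩ := T.exists_box (2 * r + 1)
  obtain ⟨u, hu1, hu2⟩ := hr q
  obtain ⟨τ, hτ⟩ := exists_shift T.letter u
  refine ⟨τ, fun z hz n => hτ n z _ ?_⟩
  have m1 : s(z - 1, z) ∈ W.biUnion fun z => {s(z - 1, z), s(z, z + gi)} :=
    Finset.mem_biUnion.2 ⟨z, hz, by simp⟩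
  have m2 : s(z, z + gi) ∈ W.biUnion fun z => {s(z - 1, z), s(z, z + gi)} :=
    Finset.mem_biUnion.2 ⟨z, hz, by simp⟩
  have hst : vertexState C z = vertexState C (z + u) := by
    have := hu2 _ m1 _ m2
    simp only [translate, Sym2.map_mk] at this
    unfold vertexState
    rw [this, show z + u - 1 = z - 1 + u by ring, show z + u + gi = z + gi + u by ring]
  rw [hst]
  obtain ⟨b1, b2⟩ := abs_le_of_norm_le (hu1 _ m1 (z + u) (by simp [translate]))
  obtain ⟨k, hk⟩ := hq (dartTo (z + u) 1 one_mem).mid (Dart.isMid _)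
    (by simp only [abs_le] at *; simp [dartTo, Dart.mid] at *; omega)
    (by simp only [abs_le] at *; simp [dartTo, Dart.mid] at *; omega)
  have key : ∃ k, (T.dart 0 k).head = z + u := by
    rcases Dart.mid_eq_mid_iff.1 hk with h | h
    · exact ⟨k, by rw [h]; simp [dartTo, Dart.head]⟩
    -- The curve runs through the west interval away from `z + u`, so the preceding dart ends there.
    · refine ⟨k - 1, ?_⟩
      have := T.track 0 (k - 1)
      rw [sub_add_cancel, h] at this
      have := congrArg Dart.tail this
      rw [next_tail] at this
      rw [← this]
      simp [dartTo, Dart.head]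
  obtain ⟨k, hk⟩ := key
  have := T.compat n 0 k
  rw [hk, hT0] at this
  simpa only [zero_add] using this

/-- Compactness: there are finitely many letters, so the streams of growing windows converge along
an ultrafilter, and each condition `Compat τ n z` involves only the first `n` letters. -/
theorem exists_letters (hC : IsCovering C) (hf : ∀ c ∈ C, c.IsFolding)
    (hlip : LocalIsomorphismProperty C) :
    ∃ τ : ℕ → Letter, ∀ n z, Compat τ n z (vertexState C z) := by
  classical
  let W : ℕ → Finset GaussianInt := fun k =>
    (Finset.Icc (-(k : ℤ)) k ×ˢ Finset.Icc (-(k : ℤ)) k).image fun p => ⟨p.1, p.2⟩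
  choose τ hτ using fun k => exists_letters_window hC hf hlip (W k)
  have : Finite Letter := Finite.of_injective (fun l : Letter => (l.odd, l.sign))
    fun l l' h => by
      simp only [Prod.mk.injEq] at h
      exact Letter.ext h.1 h.2
  let U : Ultrafilter ℕ := Filter.hyperfilter ℕ
  have hlim : ∀ n, ∃ l, ∀ᶠ k in (U : Filter ℕ), τ k n = l := by
    intro n
    obtain ⟨l, hl⟩ := Ultrafilter.eq_pure_of_finite (U.map fun k => τ k n)
    refine ⟨l, ?_⟩
    have : ({l} : Set Letter) ∈ U.map fun k => τ k n := by rw [hl]; exact Set.mem_singleton l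
    exact this
  choose σ hσ using hlim
  refine ⟨σ, fun n z => ?_⟩
  have h1 : ∀ᶠ k in (U : Filter ℕ), ∀ i < n, τ k i = σ i :=
    (Filter.eventually_all_finite (Set.finite_lt_nat n)).2 fun i _ => hσ i
  have h2 : ∀ᶠ k in (U : Filter ℕ), z ∈ W k := by
    have : ∀ᶠ k in Filter.cofinite, z ∈ W k := by
      rw [Nat.cofinite_eq_atTop]
      filter_upwards [Filter.eventually_ge_atTop (z.re.natAbs + z.im.natAbs)] with k hk
      simp only [W, Finset.mem_image, Finset.mem_product, Finset.mem_Icc]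
      exact ⟨(z.re, z.im), by omega, rfl⟩
    exact Filter.hyperfilter_le_cofinite this
  obtain ⟨k, hk1, hk2⟩ := (h1.and h2).exists
  exact (hτ k z hk2 n).congr hk1

end Covering

/-- The states at the successive levels. -/
def levelState (τ : ℕ → Letter) (s : GaussianInt → ℤˣ) : ℕ → GaussianInt → ℤˣ
  | 0 => s
  | n + 1 => (τ n).der (levelState τ s n)

theorem valid_levelState {τ : ℕ → Letter} {s : GaussianInt → ℤˣ} (h : ∀ n z, Compat τ n z (s z))
    (n : ℕ) : (τ n).Valid (levelState τ s n) := by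
  have key : ∀ m z, Compat (fun k => τ (n + k)) m z (levelState τ s n z) := by
    induction n with
    | zero => simp only [zero_add]; exact h
    | succ n ih =>
      intro m z
      have := (ih (m + 1) ((τ n).lift z)).2 z rfl
      simp only [add_assoc, add_comm 1]
      exact this
  exact fun z hz => (key 1 z).1 hz

/-! ### Finite sets of intervals under repeated coarsening -/

/-- `check accept k E`: after at most `k` coarsenings, the list `E` of doubled midpoints becomes a
list which satisfies `accept`, whatever the letters are. -/
def check (accept : List GaussianInt → Bool) : ℕ → List GaussianInt → Bool
  | 0, E => accept E
  | k + 1, E => accept E || [(0, 1), (0, -1), (1, 1), (1, -1)].all fun p : ℤ × ℤ =>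
      check accept k (E.map (coarseMidAux p.1 p.2)).dedup

/-- The list has at most four different terms. -/
def small (E : List GaussianInt) : Bool := decide (E.dedup.length ≤ 4)

/-- The doubled midpoints, relative to its centre, of a pinwheel: the four intervals at the
centre, and four more which are images of each other under rotations about the centre. -/
def pinOffsets (χ : ℤ) : List GaussianInt :=
  [⟨1, 0⟩, ⟨-1, 0⟩, ⟨2, χ⟩, ⟨-χ, 2⟩, ⟨-2, -χ⟩, ⟨χ, -2⟩, ⟨0, 1⟩, ⟨0, -1⟩]

/-- The list is contained in a pinwheel. -/
def inPinwheel (E : List GaussianInt) : Bool :=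
  [1, -1].any fun χ : ℤ => (pinOffsets χ).any fun v =>
    let m := E.headI - v
    decide (m.re % 2 = 0) && decide (m.im % 2 = 0) && E.all fun M => decide (M - m ∈ pinOffsets χ)

/-- The doubled midpoints in a square of side `4`. -/
def squareMids (a b : ℤ) : List GaussianInt :=
  ((List.range 5).flatMap fun i : ℕ => (List.range 5).map fun j : ℕ =>
    (⟨a + (i : ℤ), b + (j : ℤ)⟩ : GaussianInt)).filter fun M => decide ((M.re + M.im) % 2 = 1)

/-- Up to translation by even vectors there are four squares of side `4` to test. Four coarsenings
suffice for all choices of letters. -/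
theorem check_squareMids : [(0, 0), (0, 1), (1, 0), (1, 1)].all (fun p : ℤ × ℤ =>
    check (fun E => small E || inPinwheel E) 4 (squareMids p.1 p.2)) = true := by
  decide +kernel

/-- The letters tested are all except `(0, -χ)`. Each of them breaks the pinwheel: at most two
further coarsenings leave at most four intervals. -/
theorem check_pinwheel : [1, -1].all (fun χ : ℤ => [(0, χ), (1, 1), (1, -1)].all fun p : ℤ × ℤ =>
    check small 2 ((pinOffsets χ).map (coarseMidAux p.1 p.2)).dedup) = true := by
  decide +kernel

/-- The one remaining letter `(0, -χ)` preserves the figure and reverses its orientation, which is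
the source of the alternating signs. -/
theorem pinOffsets_coarse : [1, -1].all (fun χ : ℤ => (pinOffsets χ).all fun M =>
    decide (coarseMidAux 0 (-χ) M ∈ pinOffsets (-χ))) = true := by
  decide +kernel

theorem sign_cases {Q : ℤ → Prop} (h : ∀ χ ∈ [(1 : ℤ), -1], Q χ) (χ : ℤˣ) : Q χ := by
  rcases units_val_cases χ with h' | h' <;> rw [h'] <;> exact h _ (by simp)

/-- `E`, translated by `2 * u`, contains `F`. -/
def CoveredBy (F : Finset GaussianInt) (E : List GaussianInt) (u : GaussianInt) : Prop :=
  ∀ M ∈ F, M - 2 * u ∈ E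

/-- The images of a finite set of doubled midpoints at the successive levels. -/
structure Images (τ : ℕ → Letter) (F : ℕ → Finset GaussianInt) : Prop where
  isMid : ∀ n, ∀ M ∈ F n, IsMid M
  succ : ∀ n, F (n + 1) = (F n).image (τ n).coarseMid

section

variable {τ : ℕ → Letter} {F : ℕ → Finset GaussianInt}

theorem Letter.pair_mem (l : Letter) :
    (l.c, (l.sign : ℤ)) ∈ [((0 : ℤ), (1 : ℤ)), (0, -1), (1, 1), (1, -1)] := by
  rcases l.c_cases with h | h <;> rcases units_val_cases l.sign with h' | h' <;> simp [h, h']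

theorem IsMid.sub_two_mul {M : GaussianInt} (h : IsMid M) (u : GaussianInt) :
    IsMid (M - 2 * u) := by
  unfold IsMid at *
  simp; omega

theorem CoveredBy.succ (hF : Images τ F) {n : ℕ} {E : List GaussianInt} {u : GaussianInt}
    (h : CoveredBy (F n) E u) : CoveredBy (F (n + 1))
      (E.map (coarseMidAux ((τ n).shift u).c ((τ n).shift u).sign)).dedup ((τ n).shiftPt u) := by
  intro M hM
  rw [hF.succ, Finset.mem_image] at hM
  obtain ⟨M, hM, rfl⟩ := hM
  rw [List.mem_dedup, List.mem_map]
  refine ⟨M - 2 * u, h M hM, ?_⟩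
  have := Letter.coarseMid_add (l := τ n) ((hF.isMid n M hM).sub_two_mul u) u
  rw [sub_add_cancel] at this
  rw [this, add_sub_cancel_right]
  rfl

theorem exists_accept (hF : Images τ F) {accept : List GaussianInt → Bool} {k n : ℕ}
    {E : List GaussianInt} {u : GaussianInt} (hE : check accept k E = true)
    (h : CoveredBy (F n) E u) :
    ∃ m ≥ n, ∃ E' u', accept E' = true ∧ CoveredBy (F m) E' u' := by
  induction k generalizing n E u with
  | zero => exact ⟨n, le_rfl, E, u, hE, h⟩
  | succ k ih =>
    rw [check, Bool.or_eq_true, List.all_eq_true] at hE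
    rcases hE with hE | hE
    · exact ⟨n, le_rfl, E, u, hE, h⟩
    · obtain ⟨m, hm, H⟩ := ih (hE _ ((τ n).shift u).pair_mem) (h.succ hF)
      exact ⟨m, by omega, H⟩

theorem CoveredBy.card_le {F : Finset GaussianInt} {E : List GaussianInt} {u : GaussianInt}
    (h : CoveredBy F E u) (hE : small E = true) : F.card ≤ 4 := by
  rw [small, decide_eq_true_eq] at hE
  calc F.card = (F.image fun M => M - 2 * u).card :=
        (Finset.card_image_of_injective _ (sub_left_injective)).symm
    _ ≤ E.toFinset.card := Finset.card_le_card fun M hM => by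
        rw [Finset.mem_image] at hM
        obtain ⟨M, hM, rfl⟩ := hM
        rw [List.mem_toFinset]
        exact h M hM
    _ ≤ 4 := by rwa [List.card_toFinset]

theorem CoveredBy.pinwheel {F : Finset GaussianInt} {E : List GaussianInt} {u : GaussianInt}
    (h : CoveredBy F E u) (hE : inPinwheel E = true) :
    ∃ (χ : ℤˣ) (z : GaussianInt), CoveredBy F (pinOffsets χ) z := by
  simp only [inPinwheel, List.any_eq_true, Bool.and_eq_true, decide_eq_true_eq,
    List.all_eq_true] at hE
  obtain ⟨χ, hχ, v, -, ⟨h1, h2⟩, h3⟩ := hE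
  obtain ⟨χ', rfl⟩ : ∃ χ' : ℤˣ, χ = χ' := by
    simp only [List.mem_cons, List.not_mem_nil, or_false] at hχ
    rcases hχ with rfl | rfl
    · exact ⟨1, rfl⟩
    · exact ⟨-1, rfl⟩
  generalize E.headI - v = m at h1 h2 h3
  refine ⟨χ', u + ⟨m.re / 2, m.im / 2⟩, fun M hM => ?_⟩
  have := h3 _ (h M hM)
  convert this using 1
  ext <;> simp <;> omega

/-- Two coarsenings contract distances up to a bounded error. -/
theorem Images.contract (hF : Images τ F) {n K : ℕ}
    (h : ∀ M ∈ F n, ∀ M' ∈ F n, |M.re - M'.re| ≤ K + 5 ∧ |M.im - M'.im| ≤ K + 5) :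
    ∀ M ∈ F (n + 2), ∀ M' ∈ F (n + 2), |M.re - M'.re| ≤ K + 4 ∧ |M.im - M'.im| ≤ K + 4 := by
  have key : ∀ M ∈ F (n + 2), ∃ M₀ ∈ F n, ∃ a b a' b' M₁ : ℤ, |a| + |b| ≤ 1 ∧ |a'| + |b'| ≤ 1 ∧
      2 * M.re = M₀.im + b + a' + b' - 2 * M₁ ∧ 2 * M.im = - (M₀.re + a) + b' - a' + 2 * M₁ +
        2 * (τ n).c ∧ M₁ = (τ (n + 1)).c := by
    intro M hM
    rw [hF.succ, Finset.mem_image] at hM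
    obtain ⟨M₁, hM₁, rfl⟩ := hM
    rw [hF.succ, Finset.mem_image] at hM₁
    obtain ⟨M₀, hM₀, rfl⟩ := hM₁
    obtain ⟨h1, a, b, hab, h2, h3⟩ := coarseMidAux_spec (c := (τ n).c)
      (units_val_cases (τ n).sign) (hF.isMid n _ hM₀)
    obtain ⟨h1', a', b', hab', h2', h3'⟩ := coarseMidAux_spec (c := (τ (n + 1)).c)
      (units_val_cases (τ (n + 1)).sign) h1
    refine ⟨M₀, hM₀, a, b, a', b', (τ (n + 1)).c, hab, hab', ?_, ?_, rfl⟩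
    · simp only [Letter.coarseMid] at *; omega
    · simp only [Letter.coarseMid] at *; omega
  intro M hM M' hM'
  obtain ⟨M₀, h0, a, b, a', b', c, hab, hab', h1, h2, h3⟩ := key M hM
  obtain ⟨N₀, k0, d, e, d', e', c', hde, hde', k1, k2, k3⟩ := key M' hM'
  have := h M₀ h0 N₀ k0
  simp only [abs_le] at *
  have aux : ∀ x y : ℤ, |x| + |y| ≤ 1 → x ≤ 1 ∧ -1 ≤ x ∧ y ≤ 1 ∧ -1 ≤ y ∧ x + y ≤ 1 ∧ -1 ≤ x + y ∧
      x - y ≤ 1 ∧ -1 ≤ x - y := by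
    intro x y hxy
    have e1 := abs_nonneg x
    have e2 := abs_nonneg y
    have f1 := le_abs_self x
    have f2 := neg_abs_le x
    have f3 := le_abs_self y
    have f4 := neg_abs_le y
    omega
  have A1 := aux _ _ hab
  have A2 := aux _ _ hab'
  have A3 := aux _ _ hde
  have A4 := aux _ _ hde'
  -- Each of the two elements carries an error of at most `2`, and `(K + 5) + 4 ≤ 2 * (K + 4) + 1`.
  -- The distance `4` is where this estimate stops improving.
  omega

theorem Images.exists_close (hF : Images τ F) (n : ℕ) : ∃ m ≥ n, ∀ M ∈ F m, ∀ M' ∈ F m,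
    |M.re - M'.re| ≤ 4 ∧ |M.im - M'.im| ≤ 4 := by
  obtain ⟨K, hK⟩ : ∃ K : ℕ, ∀ M ∈ F n, ∀ M' ∈ F n,
      |M.re - M'.re| ≤ K + 4 ∧ |M.im - M'.im| ≤ K + 4 := by
    refine ⟨2 * (F n).sup fun M => M.re.natAbs + M.im.natAbs, fun M hM M' hM' => ?_⟩
    have h1 := Finset.le_sup (f := fun M : GaussianInt => M.re.natAbs + M.im.natAbs) hM
    have h2 := Finset.le_sup (f := fun M : GaussianInt => M.re.natAbs + M.im.natAbs) hM'
    simp only [abs_le] at *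
    omega
  induction K generalizing n with
  | zero => exact ⟨n, le_rfl, by simpa using hK⟩
  | succ K ih =>
    obtain ⟨m, hm, h⟩ := ih (n + 2) (hF.contract (by
      push_cast at hK
      intro M hM M' hM'
      have := hK M hM M' hM'
      constructor <;> omega))
    exact ⟨m, by omega, h⟩

theorem Images.exists_square (hF : Images τ F) (n : ℕ) : ∃ m ≥ n, ∃ p ∈
    [((0 : ℤ), (0 : ℤ)), (0, 1), (1, 0), (1, 1)], ∃ u, CoveredBy (F m) (squareMids p.1 p.2) u := by
  obtain ⟨m, hm, h⟩ := hF.exists_close n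
  refine ⟨m, hm, ?_⟩
  rcases (F m).eq_empty_or_nonempty with h0 | h0
  · exact ⟨(0, 0), by simp, 0, by simp [CoveredBy, h0]⟩
  obtain ⟨A, hA, hA'⟩ := (F m).exists_min_image (fun M => M.re) h0
  obtain ⟨B, hB, hB'⟩ := (F m).exists_min_image (fun M => M.im) h0
  -- The lower left corner is `(A.re, B.im)`. Translations of doubled midpoints are even, so only
  -- its parities remain.
  refine ⟨(A.re % 2, B.im % 2), ?_, ⟨A.re / 2, B.im / 2⟩, fun M hM => ?_⟩
  · rcases Int.emod_two_eq_zero_or_one A.re with h | h <;>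
      rcases Int.emod_two_eq_zero_or_one B.im with h' | h' <;> simp [h, h']
  · have h1 := hA' M hM
    have h2 := hB' M hM
    have h3 := (h M hM A hA).1
    have h4 := (h M hM B hB).2
    have h5 := (hF.isMid m M hM).sub_two_mul ⟨A.re / 2, B.im / 2⟩
    simp only [abs_le] at h3 h4
    simp only [squareMids, List.mem_filter, List.mem_flatMap, List.mem_map, decide_eq_true_eq]
    refine ⟨⟨(M.re - A.re).toNat, List.mem_range.2 (by omega),
      (M.im - B.im).toNat, List.mem_range.2 (by omega), ?_⟩, h5⟩
    ext <;> simp <;> omega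

/-- Sets which keep five elements end up in a pinwheel. -/
theorem Images.exists_pinwheel (hF : Images τ F) (hc : ∀ n, 5 ≤ (F n).card) :
    ∃ (n : ℕ) (χ : ℤˣ) (z : GaussianInt), CoveredBy (F n) (pinOffsets χ) z := by
  obtain ⟨m, -, p, hp, u, h⟩ := hF.exists_square 0
  have h1 := check_squareMids
  rw [List.all_eq_true] at h1
  obtain ⟨m', -, E, u', hE, hE'⟩ := exists_accept hF (h1 p hp) h
  rw [Bool.or_eq_true] at hE
  rcases hE with hE | hE
  · have := hE'.card_le hE
    have := hc m'
    omega
  · exact ⟨m', hE'.pinwheel hE⟩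

/-- A pinwheel which contains sets that keep five elements has its centre at a surviving vertex,
and the sign of its arms is opposite to the sign of the letter there. -/
theorem Images.pinwheel_succ (hF : Images τ F) (hc : ∀ n, 5 ≤ (F n).card) {n : ℕ} {χ : ℤˣ}
    {z : GaussianInt} (h : CoveredBy (F n) (pinOffsets χ) z) :
    (τ n).Mem z ∧ (τ n).tw z = -χ ∧
      CoveredBy (F (n + 1)) (pinOffsets (-χ : ℤˣ)) ((τ n).down z) := by
  have h1 := h.succ hF
  -- Any letter other than `(0, -χ)` would finally leave at most four elements, against `hc`.
  have hdie : ∀ p : ℤ × ℤ, p ∈ [(0, (χ : ℤ)), (1, 1), (1, -1)] →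
      (((τ n).shift z).c, (((τ n).shift z).sign : ℤ)) ≠ p := by
    rintro p hp rfl
    have h2 := check_pinwheel
    rw [List.all_eq_true] at h2
    have h3 := sign_cases h2 χ
    rw [List.all_eq_true] at h3
    obtain ⟨m, -, E, u, hE, hE'⟩ := exists_accept hF (h3 _ hp) h1
    have := hE'.card_le hE
    have := hc m
    omega
  have hc0 : ((τ n).shift z).c = 0 := by
    rcases ((τ n).shift z).c_cases with h | h
    · exact h
    · rcases units_val_cases ((τ n).shift z).sign with h' | h'
      · exact absurd (by rw [h, h']) (hdie (1, 1) (by simp))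
      · exact absurd (by rw [h, h']) (hdie (1, -1) (by simp))
  have hm : (τ n).Mem z := by
    rw [Letter.shift_c] at hc0
    have := (τ n).c_cases
    unfold Letter.Mem
    omega
  have hs : ((τ n).shift z).sign = -χ := by
    have h4 := hdie (0, χ) (by simp)
    rw [hc0] at h4
    rcases Int.units_eq_one_or ((τ n).shift z).sign with h | h <;>
      rcases Int.units_eq_one_or χ with h' | h' <;> simp_all
  refine ⟨hm, hs, ?_⟩
  rw [hc0, hs, Letter.shiftPt_eq_down hm] at h1
  intro M hM
  have h5 := h1 M hM
  rw [List.mem_dedup, List.mem_map] at h5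
  obtain ⟨M', hM', h6⟩ := h5
  rw [← h6]
  have h7 := pinOffsets_coarse
  rw [List.all_eq_true] at h7
  have h8 := sign_cases h7 χ
  rw [List.all_eq_true] at h8
  simpa using h8 M' hM'

/-! ### The vertex that survives at all levels -/

/-- The vertices `z n` correspond to a single vertex which survives at all levels. -/
def Central (τ : ℕ → Letter) (z : ℕ → GaussianInt) : Prop := ∀ n, z n = (τ n).lift (z (n + 1))

theorem exists_central {τ : ℕ → Letter} {z : ℕ → GaussianInt} {n₀ : ℕ}
    (h : ∀ n ≥ n₀, z n = (τ n).lift (z (n + 1))) :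
    ∃ z', Central τ z' ∧ ∀ n ≥ n₀, z' n = z n := by
  induction n₀ generalizing τ z with
  | zero => exact ⟨z, fun n => h n (by omega), fun _ _ => rfl⟩
  | succ n₀ ih =>
    obtain ⟨y, hy, hy'⟩ := ih (τ := fun n => τ (n + 1)) (z := fun n => z (n + 1))
      fun n hn => h (n + 1) (by omega)
    refine ⟨fun n => Nat.casesOn n ((τ 0).lift (y 0)) y, fun n => ?_, fun n hn => ?_⟩
    · cases n with
      | zero => rfl
      | succ n => exact hy n
    · cases n with
      | zero => omega
      | succ n => exact hy' n (by omega)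

/-- Each `lift` multiplies differences by `1 + i`, so the difference of two such vertices has a norm
divisible by every power of `2`. -/
theorem Central.unique {z z' : ℕ → GaussianInt} (h : Central τ z) (h' : Central τ z') (n : ℕ) :
    z n = z' n := by
  have h1 : ∀ n, z n - z' n = (1 + gi) * (z (n + 1) - z' (n + 1)) := by
    intro n
    rw [h n, h' n, Letter.lift_eq, Letter.lift_eq]; ring
  have h2 : ∀ k, Zsqrtd.norm (z n - z' n) = 2 ^ k * Zsqrtd.norm (z (n + k) - z' (n + k)) := by
    intro k
    induction k with
    | zero => simp
    | succ k ih =>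
      rw [ih, h1 (n + k), Zsqrtd.norm_mul, pow_succ, mul_assoc, add_assoc]
      rfl
  by_contra hne
  have hpos : Zsqrtd.norm (z n - z' n) ≠ 0 := by
    intro h0
    rw [GaussianInt.norm_eq_zero] at h0
    exact hne (sub_eq_zero.1 h0)
  have hb : ∃ k : ℕ, (Zsqrtd.norm (z n - z' n)).natAbs < 2 ^ k := ⟨_, Nat.lt_two_pow_self⟩
  obtain ⟨k, hk⟩ := hb
  have h3 : (2 ^ k : ℕ) ∣ (Zsqrtd.norm (z n - z' n)).natAbs := by
    rw [← Int.natCast_dvd]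
    exact ⟨_, by push_cast; exact h2 k⟩
  have := Nat.le_of_dvd (by omega) h3
  omega

theorem Images.exists_centre (hF : Images τ F) (hc : ∀ n, 5 ≤ (F n).card) :
    ∃ z, Central τ z ∧ ∃ n₀, ∀ n ≥ n₀, (τ (n + 1)).tw (z (n + 1)) = -(τ n).tw (z n) ∧
      CoveredBy (F n) (pinOffsets (-(τ n).tw (z n) : ℤˣ)) (z n) := by
  obtain ⟨n₀, χ, y, h⟩ := hF.exists_pinwheel hc
  -- The recursion starts at level `n₀`. The values below `n₀` are meaningless and are replaced
  -- through `exists_central`.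
  let z : ℕ → GaussianInt := fun n => Nat.rec y (fun k w => (τ (n₀ + k)).down w) (n - n₀)
  have hz : ∀ k, z (n₀ + k + 1) = (τ (n₀ + k)).down (z (n₀ + k)) := by
    intro k
    simp only [z]
    rw [show n₀ + k + 1 - n₀ = k + 1 by omega, show n₀ + k - n₀ = k by omega]
  have key : ∀ k, CoveredBy (F (n₀ + k)) (pinOffsets ((-1) ^ k * χ : ℤˣ)) (z (n₀ + k)) := by
    intro k
    induction k with
    | zero => simpa [z] using h
    | succ k ih =>
      have := (hF.pinwheel_succ hc ih).2.2
      rw [← hz] at this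
      rw [pow_succ, mul_neg_one, neg_mul]
      exact this
  obtain ⟨z', hz', h'⟩ := exists_central (τ := τ) (z := z) (n₀ := n₀) (by
    intro n hn
    obtain ⟨k, rfl⟩ := Nat.exists_eq_add_of_le hn
    rw [hz, Letter.lift_down _ (hF.pinwheel_succ hc (key k)).1])
  have htw : ∀ k, (τ (n₀ + k)).tw (z (n₀ + k)) = -((-1) ^ k * χ) := fun k =>
    (hF.pinwheel_succ hc (key k)).2.1
  refine ⟨z', hz', n₀, fun n hn => ?_⟩
  rw [h' n hn, h' (n + 1) (by omega)]
  obtain ⟨k, rfl⟩ := Nat.exists_eq_add_of_le hn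
  refine ⟨?_, ?_⟩
  · rw [add_assoc, htw, htw, pow_succ]; simp
  · rw [htw, neg_neg]; exact key k

end

/-! ### Classes of connected darts -/

/-- The dart of level `n` which contains a given dart. -/
def coarseIter (τ : ℕ → Letter) : ℕ → Dart → Dart
  | 0, d => d
  | n + 1, d => (τ n).coarse (coarseIter τ n d)

theorem exists_coarseIter_eq (τ : ℕ → Letter) (n : ℕ) (x : Dart) : ∃ d, coarseIter τ n d = x := by
  induction n generalizing x with
  | zero => exact ⟨x, rfl⟩
  | succ n ih =>
    obtain ⟨d, hd⟩ := ih ((τ n).fine x)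
    exact ⟨d, by rw [coarseIter, hd, Letter.coarse_fine]⟩

theorem coarseIter_mid_succ (τ : ℕ → Letter) (n : ℕ) (d : Dart) :
    (coarseIter τ (n + 1) d).mid = (τ n).coarseMid (coarseIter τ n d).mid :=
  (τ n).mid_coarse _

open Classical in
theorem images_coarseIter (τ : ℕ → Letter) (X : Finset Dart) :
    Images τ fun n => X.image fun d => (coarseIter τ n d).mid where
  isMid n M hM := by
    rw [Finset.mem_image] at hM
    obtain ⟨d, -, rfl⟩ := hM
    exact Dart.isMid _
  succ n := by
    rw [Finset.image_image]
    exact Finset.image_congr fun d _ => coarseIter_mid_succ τ n d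

/-- With the two checks that follow: the letter that preserves pinwheels maps one bijectively onto
the next, and only intervals at the centre become intervals at the centre. -/
theorem forall_pinOffsets_injective : [1, -1].all (fun χ : ℤ => (pinOffsets χ).all fun M =>
    (pinOffsets χ).all fun M' =>
      decide (coarseMidAux 0 (-χ) M = coarseMidAux 0 (-χ) M' → M = M')) = true := by
  decide +kernel

theorem forall_pinOffsets_surjective : [1, -1].all (fun χ : ℤ => (pinOffsets (-χ)).all fun M =>
    (pinOffsets χ).any fun M' => decide (coarseMidAux 0 (-χ) M' = M)) = true := by
  decide +kernel

theorem forall_pinOffsets_unit : [1, -1].all (fun χ : ℤ => (pinOffsets χ).all fun M =>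
    decide (coarseMidAux 0 (-χ) M ∈ [1, -1, gi, -gi] → M ∈ [1, -1, gi, -gi])) = true := by
  decide +kernel

theorem forall_pinOffsets_odd : [1, -1].all (fun χ : ℤ => (pinOffsets χ).all fun M =>
    decide ((M.re + M.im) % 2 = 1)) = true := by
  decide +kernel

theorem mem_unitVectors_iff {ε : GaussianInt} : ε ∈ unitVectors ↔ ε ∈ [1, -1, gi, -gi] := by
  simp [unitVectors]

theorem isMid_of_mem_pinOffsets {χ : ℤˣ} {M : GaussianInt} (h : M ∈ pinOffsets χ) : IsMid M := by
  have h1 := forall_pinOffsets_odd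
  simp only [List.all_eq_true] at h1
  simpa [IsMid] using sign_cases h1 χ M h

theorem Letter.coarseMid_add_of_mem {l : Letter} {z M : GaussianInt} (hz : l.Mem z)
    (hM : IsMid M) : l.coarseMid (M + 2 * z) = coarseMidAux 0 (l.tw z) M + 2 * l.down z := by
  rw [coarseMid_add hM, shiftPt_eq_down hz, coarseMid, shift_c_of_mem hz]
  rfl

theorem Letter.head_coarse_of_not_mem {l : Letter} {d : Dart} (h : ¬ l.Mem d.tail) :
    (l.coarse d).head = l.down d.head := by
  rw [coarse, if_neg h, Dart.flip_head]
  rfl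

section

variable {τ : ℕ → Letter} {s : GaussianInt → ℤˣ} {z : ℕ → GaussianInt}

theorem conn_coarseIter_iff (hv : ∀ n, (τ n).Valid (levelState τ s n)) (n : ℕ) {d e : Dart} :
    Conn (levelState τ s n) (coarseIter τ n d) (coarseIter τ n e) ↔ Conn s d e := by
  induction n with
  | zero => rfl
  | succ n ih => exact (Conn.coarse_iff (hv n)).trans ih

theorem conn_of_mid_eq (hv : ∀ n, (τ n).Valid (levelState τ s n)) {n : ℕ} {d e : Dart}
    (h : (coarseIter τ n d).mid = (coarseIter τ n e).mid) : Conn s d e :=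
  (conn_coarseIter_iff hv n).1 (Conn.of_mid h)

theorem Central.mem (hz : Central τ z) (n : ℕ) : (τ n).Mem (z n) := by
  rw [hz n]; exact Letter.mem_lift _ _

theorem Central.down (hz : Central τ z) (n : ℕ) : (τ n).down (z n) = z (n + 1) := by
  rw [hz n, Letter.down_lift]

/-- The pinwheels around the centres `z n` from the level `n₀` on. -/
structure Pinwheels (τ : ℕ → Letter) (z : ℕ → GaussianInt) (n₀ : ℕ) : Prop where
  central : Central τ z
  tw_succ : ∀ n ≥ n₀, (τ (n + 1)).tw (z (n + 1)) = -(τ n).tw (z n)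

/-- Five pairwise unconnected darts force the existence of pinwheels, which every curve meets. -/
theorem exists_pinwheels (hv : ∀ n, (τ n).Valid (levelState τ s n)) (X : Finset Dart)
    (hX : X.card = 5) (hX' : ∀ d ∈ X, ∀ e ∈ X, Conn s d e → d = e) :
    ∃ z n₀, Pinwheels τ z n₀ ∧ ∀ d, ∃ n ≥ n₀,
      (coarseIter τ n d).mid - 2 * z n ∈ pinOffsets (-(τ n).tw (z n) : ℤˣ) := by
  classical
  -- Elements of `X` are pairwise unconnected, and darts with equal images are connected, so the
  -- five images never merge.
  have hcard : ∀ Y : Finset Dart, X ⊆ Y → ∀ n,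
      5 ≤ (Y.image fun d => (coarseIter τ n d).mid).card := by
    intro Y hY n
    rw [← hX, ← Finset.card_image_of_injOn (s := X) (f := fun d => (coarseIter τ n d).mid)]
    · exact Finset.card_le_card (Finset.image_subset_image hY)
    · exact fun d hd e he h => hX' d hd e he (conn_of_mid_eq hv h)
  obtain ⟨z, hz, n₀, h⟩ := (images_coarseIter τ X).exists_centre (hcard X subset_rfl)
  refine ⟨z, n₀, ⟨hz, fun n hn => (h n hn).1⟩, fun d => ?_⟩
  -- The same argument with `d` added yields a pinwheel containing the image of `d`, and its centre
  -- is the old one by uniqueness.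
  obtain ⟨z', hz', n₁, h'⟩ := (images_coarseIter τ (insert d X)).exists_centre
    (hcard _ (Finset.subset_insert d X))
  refine ⟨max n₀ n₁, le_max_left _ _, ?_⟩
  have := (h' _ (le_max_right n₀ n₁)).2 (coarseIter τ (max n₀ n₁) d).mid
    (Finset.mem_image.2 ⟨d, Finset.mem_insert_self _ _, rfl⟩)
  rwa [hz'.unique hz] at this

/-! ### Connections that are visible at the centre -/

/-- Two darts of level `n` coincide up to orientation, or are consecutive at the centre. -/
def CentreRel (τ : ℕ → Letter) (s : GaussianInt → ℤˣ) (z : ℕ → GaussianInt) (n : ℕ) (d e : Dart) :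
    Prop :=
  d.mid = e.mid ∨ ∃ x : Dart, x.head = z n ∧ x.mid = d.mid ∧ (next (levelState τ s n) x).mid = e.mid

theorem CentreRel.symm {n : ℕ} {d e : Dart} (h : CentreRel τ s z n d e) :
    CentreRel τ s z n e d := by
  rcases h with h | ⟨x, h1, h2, h3⟩
  · exact Or.inl h.symm
  · refine Or.inr ⟨(next (levelState τ s n) x).flip, ?_, ?_, ?_⟩
    · simpa using h1
    · simpa using h3
    · rw [next_flip_next]; simpa using h2

/-- An interval at the centre has only one partner there, so two successive connections lead back to
the first interval. -/
theorem CentreRel.trans {n : ℕ} {d e f : Dart} (h : CentreRel τ s z n d e)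
    (h' : CentreRel τ s z n e f) : CentreRel τ s z n d f := by
  rcases h with h | ⟨x, h1, h2, h3⟩
  · rcases h' with h' | ⟨x, h1, h2, h3⟩
    · exact Or.inl (h.trans h')
    · exact Or.inr ⟨x, h1, h2.trans h.symm, h3⟩
  · rcases h' with h' | ⟨y, k1, k2, k3⟩
    · exact Or.inr ⟨x, h1, h2, h3.trans h'⟩
    · left
      rcases Dart.mid_eq_mid_iff.1 (k2.trans h3.symm) with rfl | rfl
      · exfalso
        rw [Dart.head, next_tail, h1] at k1
        exact (next _ x).dir_ne_zero (by simpa using k1)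
      · rw [next_flip_next] at k3
        rw [← h2, ← k3, Dart.mid_flip]

theorem CentreRel.coarse (hv : ∀ n, (τ n).Valid (levelState τ s n)) (hz : Central τ z) {n : ℕ}
    {d e : Dart} (h : CentreRel τ s z n d e) :
    CentreRel τ s z (n + 1) ((τ n).coarse d) ((τ n).coarse e) := by
  rcases h with h | ⟨x, h1, h2, h3⟩
  · left; rw [Letter.mid_coarse, Letter.mid_coarse, h]
  · have hm : ¬ (τ n).Mem x.tail := Dart.mem_head_iff.1 (h1 ▸ hz.mem n)
    refine Or.inr ⟨(τ n).coarse x, ?_, ?_, ?_⟩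
    · rw [Letter.head_coarse_of_not_mem hm, h1, hz.down]
    · rw [Letter.mid_coarse, Letter.mid_coarse, h2]
    · rw [levelState, ← Letter.coarse_next_of_not_mem (hv n) hm, Letter.mid_coarse,
        Letter.mid_coarse, h3]

theorem CentreRel.coarseIter_of_le (hv : ∀ n, (τ n).Valid (levelState τ s n)) (hz : Central τ z)
    {n m : ℕ} (hnm : n ≤ m) {d e : Dart}
    (h : CentreRel τ s z n (coarseIter τ n d) (coarseIter τ n e)) :
    CentreRel τ s z m (coarseIter τ m d) (coarseIter τ m e) := by
  induction m, hnm using Nat.le_induction with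
  | base => exact h
  | succ m _ ih => exact ih.coarse hv hz

/-- Two consecutive segments merge at the first level where their common vertex does not survive. If
this never happens, that vertex is the centre, by uniqueness. -/
theorem exists_centreRel (hv : ∀ n, (τ n).Valid (levelState τ s n)) (hz : Central τ z)
    {d e : Dart} (h : Conn s d e) :
    ∃ n, CentreRel τ s z n (coarseIter τ n d) (coarseIter τ n e) := by
  induction h with
  | rel d e h =>
    rcases h with rfl | rfl
    · exact ⟨0, Or.inl (Dart.mid_flip d).symm⟩
    · by_contra! hcon
      have key : ∀ n, coarseIter τ n (next s d) = next (levelState τ s n) (coarseIter τ n d) ∧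
          ¬ (τ n).Mem (coarseIter τ n d).tail := by
        have aux : ∀ n, coarseIter τ n (next s d) = next (levelState τ s n) (coarseIter τ n d) →
            ¬ (τ n).Mem (coarseIter τ n d).tail := by
          intro n hn hm
          apply hcon (n + 1)
          left
          rw [coarseIter, coarseIter, hn, Letter.coarse_next_of_mem hm
            (hv n _ (by rw [Dart.mem_head_iff]; simpa using hm))]
        intro n
        induction n with
        | zero => exact ⟨rfl, aux 0 rfl⟩
        | succ n ih =>
          have : coarseIter τ (n + 1) (next s d) =
              next (levelState τ s (n + 1)) (coarseIter τ (n + 1) d) := by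
            rw [coarseIter, ih.1, Letter.coarse_next_of_not_mem (hv n) ih.2]; rfl
          exact ⟨this, aux _ this⟩
      have hc : Central τ fun n => (coarseIter τ n d).head := by
        intro n
        simp only [coarseIter]
        rw [Letter.head_coarse_of_not_mem (key n).2,
          Letter.lift_down _ (Dart.mem_head_iff.2 (key n).2)]
      exact hcon 0 (Or.inr ⟨d, hc.unique hz 0, rfl, rfl⟩)
  | refl d => exact ⟨0, Or.inl rfl⟩
  | symm d e _ ih =>
    obtain ⟨n, h⟩ := ih
    exact ⟨n, h.symm⟩
  | trans d e f _ _ h1 h2 =>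
    obtain ⟨n, h1⟩ := h1
    obtain ⟨m, h2⟩ := h2
    exact ⟨max n m, (h1.coarseIter_of_le hv hz (le_max_left _ _)).trans
      (h2.coarseIter_of_le hv hz (le_max_right _ _))⟩

/-! ### The six curves of a persistent pinwheel -/

/-- The dart `d` of level `n` belongs to the pinwheel. -/
def InPinwheel (τ : ℕ → Letter) (z : ℕ → GaussianInt) (n : ℕ) (d : Dart) : Prop :=
  d.mid - 2 * z n ∈ pinOffsets (-(τ n).tw (z n) : ℤˣ)

namespace Pinwheels

variable {n₀ : ℕ}

theorem mid_coarse_sub (hp : Pinwheels τ z n₀) {n : ℕ} (d : Dart) :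
    ((τ n).coarse d).mid - 2 * z (n + 1) = coarseMidAux 0 ((τ n).tw (z n)) (d.mid - 2 * z n) := by
  have := Letter.coarseMid_add_of_mem (hp.central.mem n) (d.isMid.sub_two_mul (z n))
  rw [sub_add_cancel, hp.central.down] at this
  rw [Letter.mid_coarse, this, add_sub_cancel_right]

theorem coarse (hp : Pinwheels τ z n₀) {n : ℕ} (hn : n₀ ≤ n) {d : Dart} (h : InPinwheel τ z n d) :
    InPinwheel τ z (n + 1) ((τ n).coarse d) := by
  unfold InPinwheel at *
  rw [hp.mid_coarse_sub, hp.tw_succ n hn]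
  have h1 := pinOffsets_coarse
  simp only [List.all_eq_true] at h1
  simpa using sign_cases h1 (-(τ n).tw (z n)) _ h

theorem mid_injective (hp : Pinwheels τ z n₀) {n : ℕ} {d e : Dart} (hd : InPinwheel τ z n d)
    (he : InPinwheel τ z n e) (h : ((τ n).coarse d).mid = ((τ n).coarse e).mid) :
    d.mid = e.mid := by
  have h1 := forall_pinOffsets_injective
  simp only [List.all_eq_true] at h1
  have h2 := sign_cases h1 (-(τ n).tw (z n)) _ hd _ he
  have h3 : ((τ n).coarse d).mid - 2 * z (n + 1) = ((τ n).coarse e).mid - 2 * z (n + 1) := by rw [h]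
  rw [hp.mid_coarse_sub, hp.mid_coarse_sub] at h3
  simpa using of_decide_eq_true h2 (by simpa using h3)

theorem surjective (hp : Pinwheels τ z n₀) {n : ℕ} (hn : n₀ ≤ n) {d : Dart}
    (h : InPinwheel τ z (n + 1) d) :
    ∃ e, InPinwheel τ z n e ∧ ((τ n).coarse e).mid = d.mid := by
  have h1 := forall_pinOffsets_surjective
  simp only [List.all_eq_true, List.any_eq_true, decide_eq_true_eq] at h1
  unfold InPinwheel at h
  rw [hp.tw_succ n hn] at h
  obtain ⟨M, hM, hM'⟩ := sign_cases h1 (-(τ n).tw (z n)) _ (by simpa using h)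
  obtain ⟨e, he⟩ := ((isMid_of_mem_pinOffsets hM).add_two_mul (z n)).exists_dart
  have he' : e.mid - 2 * z n = M := by rw [he]; ring
  refine ⟨e, by rw [InPinwheel, he']; exact hM, ?_⟩
  have h2 := hp.mid_coarse_sub (n := n) e
  rw [he'] at h2
  simp only [Units.val_neg, neg_neg] at hM'
  rw [hM'] at h2
  simpa using h2

/-- Coarsening is injective on the pinwheel and reflects adjacency to the centre, so it creates no
new connection there. -/
theorem centreRel_of_coarse (hp : Pinwheels τ z n₀) {n : ℕ}
    (hv : ∀ n, (τ n).Valid (levelState τ s n))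
    {d e : Dart} (hd : InPinwheel τ z n d) (he : InPinwheel τ z n e)
    (h : CentreRel τ s z (n + 1) ((τ n).coarse d) ((τ n).coarse e)) : CentreRel τ s z n d e := by
  rcases h with h | ⟨x, h1, h2, h3⟩
  · exact Or.inl (hp.mid_injective hd he h)
  · have hx : ((τ n).coarse d).mid - 2 * z (n + 1) = -x.dir := by
      rw [← h2, Dart.mid, ← h1, Dart.head]; ring
    have hu : d.mid - 2 * z n ∈ unitVectors := by
      have k1 := forall_pinOffsets_unit
      simp only [List.all_eq_true] at k1
      have k2 := of_decide_eq_true (sign_cases k1 (-(τ n).tw (z n)) _ hd)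
      rw [Units.val_neg, neg_neg, ← hp.mid_coarse_sub, hx, ← mem_unitVectors_iff,
        ← mem_unitVectors_iff] at k2
      exact k2 (neg_mem_unitVectors x.mem)
    let y : Dart := dartTo (z n) (-(d.mid - 2 * z n)) (neg_mem_unitVectors hu)
    have hy1 : y.head = z n := by simp [y, dartTo, Dart.head]
    have hy2 : y.mid = d.mid := by simp [y, dartTo, Dart.mid]; ring
    have hm : ¬ (τ n).Mem y.tail := Dart.mem_head_iff.1 (hy1 ▸ hp.central.mem n)
    have hyx : (τ n).coarse y = x := by
      have h4 : ((τ n).coarse y).mid = x.mid := by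
        rw [h2, Letter.mid_coarse, Letter.mid_coarse, hy2]
      rcases Dart.mid_eq_mid_iff.1 h4 with h5 | h5
      · exact h5
      · exfalso
        have h6 := Letter.head_coarse_of_not_mem hm
        rw [hy1, hp.central.down, h5, Dart.flip_head, ← h1, Dart.head] at h6
        exact x.dir_ne_zero (by simpa using h6.symm)
    refine Or.inr ⟨y, hy1, hy2, ?_⟩
    apply hp.mid_injective _ he
    · rw [Letter.coarse_next_of_not_mem (hv n) hm, hyx]; exact h3
    · unfold InPinwheel
      have h7 : (next (levelState τ s n) y).mid - 2 * z n = (next (levelState τ s n) y).dir := by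
        rw [Dart.mid, next_tail, hy1]; ring
      rw [h7]
      rcases (next (levelState τ s n) y).mem with h | h | h | h <;> rw [h] <;>
        simp [pinOffsets, Zsqrtd.ext_iff]

theorem inPinwheel_coarseIter (hp : Pinwheels τ z n₀) {n : ℕ} (hn : n₀ ≤ n) {d : Dart}
    (h : InPinwheel τ z n₀ (coarseIter τ n₀ d)) : InPinwheel τ z n (coarseIter τ n d) := by
  induction n, hn using Nat.le_induction with
  | base => exact h
  | succ n hn ih => exact hp.coarse hn ih

/-- Connectedness can be read off from the first pinwheel. -/
theorem centreRel_of_conn (hp : Pinwheels τ z n₀) (hv : ∀ n, (τ n).Valid (levelState τ s n))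
    {d e : Dart}
    (hd : InPinwheel τ z n₀ (coarseIter τ n₀ d)) (he : InPinwheel τ z n₀ (coarseIter τ n₀ e))
    (h : Conn s d e) : CentreRel τ s z n₀ (coarseIter τ n₀ d) (coarseIter τ n₀ e) := by
  obtain ⟨n, h⟩ := exists_centreRel hv hp.central h
  have h1 := h.coarseIter_of_le hv hp.central (le_max_left n n₀)
  have key : ∀ m ≥ n₀, CentreRel τ s z m (coarseIter τ m d) (coarseIter τ m e) →
      CentreRel τ s z n₀ (coarseIter τ n₀ d) (coarseIter τ n₀ e) := by
    intro m hm
    induction m, hm using Nat.le_induction with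
    | base => exact id
    | succ m hm ih =>
      exact fun h => ih (hp.centreRel_of_coarse hv (hp.inPinwheel_coarseIter hm hd)
        (hp.inPinwheel_coarseIter hm he) h)
  exact key _ (le_max_right _ _) h1

/-- Pulling back through surjectivity shows that a curve meeting a later pinwheel already meets the
first one. -/
theorem exists_conn (hp : Pinwheels τ z n₀) (hv : ∀ n, (τ n).Valid (levelState τ s n))
    {d : Dart} {n : ℕ} (hn : n₀ ≤ n)
    (h : InPinwheel τ z n (coarseIter τ n d)) :
    ∃ e, InPinwheel τ z n₀ (coarseIter τ n₀ e) ∧ Conn s d e := by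
  suffices H : ∃ e, InPinwheel τ z n₀ (coarseIter τ n₀ e) ∧
      (coarseIter τ n e).mid = (coarseIter τ n d).mid by
    obtain ⟨e, h1, h2⟩ := H
    exact ⟨e, h1, conn_of_mid_eq hv h2.symm⟩
  induction n, hn using Nat.le_induction generalizing d with
  | base => exact ⟨d, h, rfl⟩
  | succ n hn ih =>
    obtain ⟨x, hx, hx'⟩ := hp.surjective hn h
    obtain ⟨x, rfl⟩ := exists_coarseIter_eq τ n x
    obtain ⟨e, he, he'⟩ := ih hx
    refine ⟨e, he, ?_⟩
    rw [coarseIter_mid_succ, he', ← Letter.mid_coarse, hx']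

/-- The pinwheel meets exactly six classes: the darts at the centre are connected in pairs. -/
theorem exists_six (hp : Pinwheels τ z n₀) (hv : ∀ n, (τ n).Valid (levelState τ s n))
    (hall : ∀ d, ∃ n ≥ n₀, InPinwheel τ z n (coarseIter τ n d)) :
    ∃ P : GaussianInt → Dart, ∃ O : Finset GaussianInt, O.card = 6 ∧
      (∀ M ∈ O, ∀ M' ∈ O, Conn s (P M) (P M') → M = M') ∧ ∀ d, ∃ M ∈ O, Conn s d (P M) := by
  have hP : ∀ M : GaussianInt, ∃ d, IsMid M → (coarseIter τ n₀ d).mid = M + 2 * z n₀ := by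
    intro M
    by_cases hM : IsMid M
    · obtain ⟨x, hx⟩ := (hM.add_two_mul (z n₀)).exists_dart
      obtain ⟨d, rfl⟩ := exists_coarseIter_eq τ n₀ x
      exact ⟨d, fun _ => hx⟩
    · exact ⟨⟨0, 1, one_mem⟩, fun h => absurd h hM⟩
  choose P hP using hP
  set χ : ℤˣ := -(τ n₀).tw (z n₀) with hχ
  have hP' : ∀ M ∈ pinOffsets χ, (coarseIter τ n₀ (P M)).mid = M + 2 * z n₀ :=
    fun M hM => hP M (isMid_of_mem_pinOffsets hM)
  have hin : ∀ M ∈ pinOffsets χ, InPinwheel τ z n₀ (coarseIter τ n₀ (P M)) := by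
    intro M hM
    rw [InPinwheel, hP' M hM, add_sub_cancel_right]
    exact hM
  -- The first six offsets are the two horizontal intervals at the centre and the four arms. The two
  -- omitted ones are the vertical intervals at the centre.
  have hsub : ∀ M ∈ (pinOffsets χ).take 6, M ∈ pinOffsets χ := fun M hM => List.mem_of_mem_take hM
  refine ⟨P, ((pinOffsets χ).take 6).toFinset, ?_, ?_, ?_⟩
  · rcases Int.units_eq_one_or χ with h | h <;> rw [h] <;> decide
  · intro M hM M' hM' h
    rw [List.mem_toFinset] at hM hM'
    rcases hp.centreRel_of_conn hv (hin M (hsub M hM)) (hin M' (hsub M' hM')) h with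
      h | ⟨x, h1, h2, h3⟩
    · rw [hP' M (hsub M hM), hP' M' (hsub M' hM')] at h
      simpa using h
    -- Intervals joined at the centre are a horizontal and a vertical one, but the list of six
    -- contains no vertical interval at the centre.
    · exfalso
      rw [hP' M (hsub M hM), Dart.mid, ← h1, Dart.head] at h2
      rw [hP' M' (hsub M' hM'), Dart.mid, next_tail, h1] at h3
      have e1 : M = -x.dir := by linear_combination -h2
      have e2 : M' = ((turnAt (levelState τ s n₀) x : ℤ) : GaussianInt) * gi * x.dir := by
        change _ + ((turnAt (levelState τ s n₀) x : ℤ) : GaussianInt) * gi * x.dir = _ at h3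
        linear_combination -h3
      generalize turnAt (levelState τ s n₀) x = t at e2
      rw [e1] at hM
      rw [e2] at hM'
      have hx := x.mem
      generalize x.dir = ε at hx hM hM'
      rcases Int.units_eq_one_or χ with h | h <;> rw [h] at hM hM' <;>
        rcases Int.units_eq_one_or t with rfl | rfl <;>
        rcases hx with rfl | rfl | rfl | rfl <;> revert hM hM' <;> decide
  · intro d
    obtain ⟨n, hn, h⟩ := hall d
    obtain ⟨e, he, hde⟩ := hp.exists_conn hv hn h
    -- A vertical interval at the centre is joined there to a horizontal one, which belongs to the
    -- six.
    have hcon : ∀ M ∈ pinOffsets χ, ∃ M' ∈ (pinOffsets χ).take 6, Conn s (P M) (P M') := by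
      intro M hM
      by_cases h6 : M ∈ (pinOffsets χ).take 6
      · exact ⟨M, h6, Conn.refl _⟩
      have hM' : M = gi ∨ M = -gi := by
        simp only [pinOffsets, List.take, List.mem_cons, List.not_mem_nil, or_false] at hM h6
        have e1 : gi = ⟨0, 1⟩ := rfl
        have e2 : -gi = ⟨0, -1⟩ := by decide
        rw [e2, e1]
        tauto
      have hMu : M ∈ unitVectors := by rcases hM' with rfl | rfl <;> simp [unitVectors]
      let x : Dart := dartTo (z n₀) (-M) (neg_mem_unitVectors hMu)
      have hx1 : x.mid = (coarseIter τ n₀ (P M)).mid := by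
        rw [hP' M hM]; simp [x, dartTo, Dart.mid]; ring
      have hx2 : x.head = z n₀ := by simp [x, dartTo, Dart.head]
      have hx3 : (next (levelState τ s n₀) x).mid =
          (next (levelState τ s n₀) x).dir + 2 * z n₀ := by
        rw [Dart.mid, next_tail, hx2]; ring
      have hx4 : (next (levelState τ s n₀) x).dir ∈ (pinOffsets χ).take 6 := by
        have e : (next (levelState τ s n₀) x).dir =
          ((turnAt (levelState τ s n₀) x : ℤ) : GaussianInt) * gi * -M := rfl
        rw [e]
        generalize turnAt (levelState τ s n₀) x = t
        rcases Int.units_eq_one_or χ with h | h <;> rw [h] <;>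
          rcases Int.units_eq_one_or t with rfl | rfl <;>
          rcases hM' with rfl | rfl <;> decide
      refine ⟨_, hx4, (conn_coarseIter_iff hv n₀).1 ?_⟩
      refine ((Conn.of_mid hx1).symm.trans (Conn.next x)).trans (Conn.of_mid ?_)
      rw [hP' _ (hsub _ hx4), hx3]
    obtain ⟨M', hM', h'⟩ := hcon _ he
    refine ⟨M', List.mem_toFinset.2 hM', (hde.trans ?_).trans h'⟩
    apply conn_of_mid_eq hv (n := n₀)
    rw [hP' _ he]
    ring

end Pinwheels

end

/-! ### The rotations about the centre -/

namespace Letter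

variable {l : Letter} {s : GaussianInt → ℤˣ}

theorem iterate_next_two_mul (hv : l.Valid s) {d : Dart} (h : l.Mem d.tail) (j : ℕ) :
    (next s)^[2 * j] d = l.fine ((next (l.der s))^[j] (l.coarse d)) := by
  induction j with
  | zero => exact (fine_coarse h).symm
  | succ j ih =>
    rw [show 2 * (j + 1) = 2 * j + 1 + 1 by ring, Function.iterate_succ_apply',
      Function.iterate_succ_apply', ih, Function.iterate_succ_apply']
    generalize (next (l.der s))^[j] (l.coarse d) = x
    have hm : l.Mem (l.fine x).tail := l.mem_lift _
    have := fine_next_coarse hm (hv _ (by rw [Dart.mem_head_iff]; simpa using hm))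
    rw [← this, coarse_fine]

theorem turnAt_iterate_two_mul (hv : l.Valid s) {d : Dart} (h : l.Mem d.tail) (j : ℕ) :
    turnAt s ((next s)^[2 * j] d) = (-1) ^ j * l.tw d.tail := by
  have hm : ∀ j, l.Mem ((next s)^[2 * j] d).tail := fun j => by
    rw [iterate_next_two_mul hv h]; exact l.mem_lift _
  rw [turnAt_of_mem (hv _ (by rw [Dart.mem_head_iff]; simpa using hm j))]
  induction j with
  | zero => simp
  | succ j ih =>
    rw [show 2 * (j + 1) = 2 * j + 1 + 1 by ring, Function.iterate_succ_apply',
      Function.iterate_succ_apply', next_tail, tw_next_head, ih, pow_succ]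
    simp

theorem turnAt_iterate_two_mul_add_one (hv : l.Valid s) {d : Dart} (h : l.Mem d.tail) (j : ℕ) :
    turnAt s ((next s)^[2 * j + 1] d) = turnAt (l.der s) ((next (l.der s))^[j] (l.coarse d)) := by
  have hm : l.Mem ((next s)^[2 * j] d).tail := by
    rw [iterate_next_two_mul hv h]; exact l.mem_lift _
  rw [Function.iterate_succ_apply',
    ← turnAt_der hm (hv _ (by rw [Dart.mem_head_iff]; simpa using hm)),
    iterate_next_two_mul hv h, coarse_fine]

theorem tail_coarse_of_mem {d : Dart} (h : l.Mem d.tail) : (l.coarse d).tail = l.down d.tail := by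
  rw [coarse_of_mem h]; rfl

theorem lift_add (z w : GaussianInt) : l.lift (z + w) = l.lift z + (1 + gi) * w := by
  rw [lift_eq, lift_eq]; ring

theorem apply_lift (z : GaussianInt) : s (l.lift z) = l.tw (l.lift z) * l.der s z := by
  rw [der, ← mul_assoc, Int.units_mul_self, one_mul]

end Letter

theorem paritySign_eq_iff {m n : ℤ} : paritySign m = paritySign n ↔ (m + n) % 2 = 0 := by
  have h : (-1 : ℤˣ) ≠ 1 := by decide
  unfold paritySign; split_ifs <;> simp [h, h.symm] <;> omega

theorem paritySign_eq_neg {m n : ℤ} (h : (m + n) % 2 = 1) : paritySign m = -paritySign n := by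
  unfold paritySign; split_ifs <;> first | omega | simp

/-- The image of a dart under the rotation of angle `π / 2` about `z`. -/
def rotAt (z : GaussianInt) (d : Dart) : Dart :=
  ⟨z + gi * (d.tail - z), gi * d.dir, gi_mul_mem_unitVectors d.mem⟩

theorem rotAt_tail (z : GaussianInt) (d : Dart) : (rotAt z d).tail = z + gi * (d.tail - z) := rfl

theorem rotAt_head (z : GaussianInt) (d : Dart) : (rotAt z d).head = z + gi * (d.head - z) := by
  simp only [rotAt, Dart.head]; ring

theorem axisSign_gi_mul {ε : GaussianInt} (h : ε ∈ unitVectors) :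
    axisSign (gi * ε) = -axisSign ε := by
  rcases h with rfl | rfl | rfl | rfl <;> decide

theorem next_rotAt {s : GaussianInt → ℤˣ} {z : GaussianInt}
    (hs : ∀ v ≠ 0, s (z + gi * v) = -s (z + v)) {d : Dart} (hd : d.head ≠ z) :
    next s (rotAt z d) = rotAt z (next s d) := by
  have ht : turnAt s (rotAt z d) = turnAt s d := by
    rw [turnAt, turnAt, rotAt_head, hs _ (sub_ne_zero.2 hd), add_sub_cancel]
    change axisSign (gi * d.dir) * _ = _
    rw [axisSign_gi_mul d.mem, neg_mul_neg]
  ext1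
  · rw [next_tail, rotAt_head, rotAt_tail, next_tail]
  · change ((turnAt s (rotAt z d) : ℤ) : GaussianInt) * gi * (gi * d.dir) =
      gi * (((turnAt s d : ℤ) : GaussianInt) * gi * d.dir)
    rw [ht]; ring

section

variable {τ : ℕ → Letter} {s : GaussianInt → ℤˣ} {z : ℕ → GaussianInt}

/-- Induction on the norm of `v`. If `1 + i` divides `v`, the question passes to the next level,
where the norm is halved. Otherwise both vertices have states given by `tw`, and their imaginary
parts have opposite parities. As a quarter turn exchanges the two kinds of vertices, the covering is
invariant under it away from the centre. -/
theorem Central.levelState_rotate (hz : Central τ z) (hv : ∀ n, (τ n).Valid (levelState τ s n))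
    (n : ℕ) {v : GaussianInt} (h0 : v ≠ 0) :
    levelState τ s n (z n + gi * v) = -levelState τ s n (z n + v) := by
  obtain ⟨N, hN⟩ : ∃ N : ℕ, v.re ^ 2 + v.im ^ 2 ≤ N :=
    ⟨(v.re ^ 2 + v.im ^ 2).toNat, Int.self_le_toNat _⟩
  induction N generalizing n v with
  | zero =>
    refine absurd ?_ h0
    have h1 : v.re ^ 2 = 0 := by push_cast at hN; nlinarith [sq_nonneg v.re, sq_nonneg v.im]
    have h2 : v.im ^ 2 = 0 := by push_cast at hN; nlinarith [sq_nonneg v.re, sq_nonneg v.im]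
    ext
    · simpa using h1
    · simpa using h2
  | succ N ih =>
    have hm := hz.mem n
    have hc := (τ n).c_cases
    by_cases hp : (v.re + v.im) % 2 = 0
    · obtain ⟨w, rfl⟩ : ∃ w, v = (1 + gi) * w :=
        ⟨⟨(v.re + v.im) / 2, (v.im - v.re) / 2⟩, by ext <;> simp <;> omega⟩
      have hw : w ≠ 0 := by rintro rfl; simp at h0
      have hwN : w.re ^ 2 + w.im ^ 2 ≤ N := by
        have e : ((1 + gi) * w).re ^ 2 + ((1 + gi) * w).im ^ 2 = 2 * (w.re ^ 2 + w.im ^ 2) := by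
          simp; ring
        rw [e] at hN
        have : 0 < w.re ^ 2 + w.im ^ 2 := by
          by_contra hle
          have h1 : w.re ^ 2 = 0 := by nlinarith [sq_nonneg w.re, sq_nonneg w.im]
          have h2 : w.im ^ 2 = 0 := by nlinarith [sq_nonneg w.re, sq_nonneg w.im]
          exact hw (by ext <;> [simpa using h1; simpa using h2])
        push_cast at hN
        omega
      have e1 : z n + (1 + gi) * w = (τ n).lift (z (n + 1) + w) := by
        rw [Letter.lift_add, ← hz n]
      have e2 : z n + gi * ((1 + gi) * w) = (τ n).lift (z (n + 1) + gi * w) := by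
        rw [Letter.lift_add, ← hz n]; ring
      have e3 : (τ n).tw (z n + gi * ((1 + gi) * w)) = (τ n).tw (z n + (1 + gi) * w) := by
        unfold Letter.tw
        rw [paritySign_eq_iff.2]
        simp; omega
      have h3 := ih (n + 1) hw hwN
      rw [e1, e2] at e3 ⊢
      rw [Letter.apply_lift (s := levelState τ s n), Letter.apply_lift (s := levelState τ s n), e3]
      change _ * levelState τ s (n + 1) _ = -(_ * levelState τ s (n + 1) _)
      rw [h3, mul_neg]
    · unfold Letter.Mem at hm
      rw [hv n (z n + gi * v), hv n (z n + v)]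
      · unfold Letter.tw
        rw [paritySign_eq_neg (n := (z n + v).im), mul_neg]
        simp; omega
      · simp [Letter.Mem]; omega
      · simp [Letter.Mem]; omega

/-- Infinite descent: surviving vertices are met at even steps only, so a return to the centre would
give a return in half as many steps at the next level. Hence the exceptional state of the centre
never disturbs the rotation. -/
theorem Central.tail_iterate_ne (hz : Central τ z) (hv : ∀ n, (τ n).Valid (levelState τ s n))
    {k : ℕ} (hk : k ≠ 0) {n : ℕ} {d : Dart} (hd : d.tail = z n) :
    ((next (levelState τ s n))^[k] d).tail ≠ z n := by
  induction k using Nat.strong_induction_on generalizing n d with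
  | _ k ih =>
    have hm : (τ n).Mem d.tail := hd ▸ hz.mem n
    rcases Nat.even_or_odd' k with ⟨j, rfl | rfl⟩
    · rw [Letter.iterate_next_two_mul (hv n) hm]
      intro h
      refine ih j (by omega) (by omega) (n := n + 1) (d := (τ n).coarse d) ?_ ?_
      · rw [Letter.tail_coarse_of_mem hm, hd, hz.down]
      · exact (τ n).lift_injective (h.trans (hz n))
    · intro h
      have hm' : (τ n).Mem ((next (levelState τ s n))^[2 * j] d).tail := by
        rw [Letter.iterate_next_two_mul (hv n) hm]; exact (τ n).mem_lift _
      rw [Function.iterate_succ_apply', next_tail] at h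
      exact Dart.mem_head_iff.1 (h ▸ hz.mem n) hm'

theorem Central.iterate_rotAt (hz : Central τ z) (hv : ∀ n, (τ n).Valid (levelState τ s n))
    {d : Dart} (hd : d.tail = z 0) (k : ℕ) :
    (next s)^[k] (rotAt (z 0) d) = rotAt (z 0) ((next s)^[k] d) := by
  induction k with
  | zero => rfl
  | succ k ih =>
    rw [Function.iterate_succ_apply', Function.iterate_succ_apply', ih, next_rotAt]
    · exact fun v h => hz.levelState_rotate hv 0 h
    · have := hz.tail_iterate_ne hv k.succ_ne_zero hd
      rwa [Function.iterate_succ_apply', next_tail] at this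

theorem Central.tail_iterate_rotAt (hz : Central τ z)
    (hv : ∀ n, (τ n).Valid (levelState τ s n)) {d : Dart} (hd : d.tail = z 0) (j k : ℕ) :
    ((next s)^[k] ((rotAt (z 0))^[j] d)).tail =
      z 0 + gi ^ j * (((next s)^[k] d).tail - z 0) := by
  induction j generalizing d with
  | zero => simp
  | succ j ih =>
    rw [Function.iterate_succ_apply, ih (by simp [rotAt_tail, hd]), hz.iterate_rotAt hv hd,
      rotAt_tail]
    ring

/-- The half curve which starts with a given dart. -/
def walk (s : GaussianInt → ℤˣ) (d : Dart) : HalfCurve where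
  pt k := ((next s)^[k] d).tail
  dir k := ((next s)^[k] d).dir
  turn k := turnAt s ((next s)^[k] d)
  dir_mem k := Dart.mem _
  pt_succ k := by rw [Function.iterate_succ_apply']; rfl
  dir_succ k := by rw [Function.iterate_succ_apply']; rfl

theorem Central.coarseIter_tail (hz : Central τ z) {d : Dart} (hd : d.tail = z 0) (n : ℕ) :
    (coarseIter τ n d).tail = z n := by
  induction n with
  | zero => exact hd
  | succ n ih => rw [coarseIter, Letter.tail_coarse_of_mem (ih ▸ hz.mem n), ih, hz.down]

/-- Passing to the next level derives the sequence of turns of a half curve from the centre, and its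
first turn at level `n` is the sign of the centre at that level. These signs alternate from `n₀` on.
-/
theorem Pinwheels.isAlternatingOrPrimitive {n₀ : ℕ} (hp : Pinwheels τ z n₀)
    (hv : ∀ n, (τ n).Valid (levelState τ s n)) {d : Dart} (hd : d.tail = z 0) :
    IsAlternatingOrPrimitive (walk s d).turn := by
  let a : ℕ → ℕ → ℤˣ := fun n => (walk (levelState τ s n) (coarseIter τ n d)).turn
  have ht := hp.central.coarseIter_tail hd
  have hm : ∀ n, (τ n).Mem (coarseIter τ n d).tail := fun n => ht n ▸ hp.central.mem n
  have h0 : ∀ n j, a n (2 * j) = (-1) ^ j * (τ n).tw (z n) := fun n j => by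
    rw [← ht n]; exact Letter.turnAt_iterate_two_mul (hv n) (hm n) j
  have h1 : ∀ n j, a n (2 * j + 1) = a (n + 1) j := fun n j =>
    Letter.turnAt_iterate_two_mul_add_one (hv n) (hm n) j
  have hinf := isInfFoldingSeq_of_derived a _ h0 h1
  have hder : ∀ k, derivedSeq^[k] (a 0) = a k := by
    intro k
    induction k with
    | zero => rfl
    | succ k ih => rw [Function.iterate_succ_apply', ih]; exact funext (h1 k)
  have hpow : ∀ m n, a n (2 ^ m - 1) = (τ (n + m)).tw (z (n + m)) := by
    intro m
    induction m with
    | zero => intro n; simpa using h0 n 0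
    | succ m ih =>
      intro n
      have : 2 ^ (m + 1) - 1 = 2 * (2 ^ m - 1) + 1 := by
        have := Nat.one_le_two_pow (n := m)
        rw [pow_succ]; omega
      rw [this, h1, ih, show n + 1 + m = n + (m + 1) by ring]
  have halt : ∀ n ≥ n₀, ∀ m, (τ (n + m)).tw (z (n + m)) = (-1) ^ m * (τ n).tw (z n) := by
    intro n hn m
    induction m with
    | zero => simp
    | succ m ih =>
      rw [← add_assoc, hp.tw_succ _ (by omega), ih, pow_succ]
      simp
  -- The alternating sequence must begin with `1`, which may require one level beyond `n₀`.
  obtain ⟨k, hk, hk1⟩ : ∃ k ≥ n₀, (τ k).tw (z k) = 1 := by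
    rcases Int.units_eq_one_or ((τ n₀).tw (z n₀)) with h | h
    · exact ⟨n₀, le_rfl, h⟩
    · exact ⟨n₀ + 1, by omega, by rw [hp.tw_succ n₀ le_rfl, h, neg_neg]⟩
  refine ⟨hinf 0, k, ?_⟩
  change IsAlternatingSeq (derivedSeq^[k] (a 0))
  rw [hder]
  exact ⟨hinf k, fun m => by rw [hpow, halt k hk, hk1, mul_one]⟩

end

/-! ### Coverings generated by half curves -/

section

variable {C : Set CompleteCurve}

theorem IsCovering.exists_walk (hC : IsCovering C) (d : Dart) : ∃ c ∈ C, ∃ m : ℤ,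
    (∀ k : ℕ, c.pt (m + k) = ((next (vertexState C))^[k] d).tail) ∨
      (∀ k : ℕ, c.pt (m - k) = ((next (vertexState C))^[k] d).tail) := by
  obtain ⟨c, hc, m, h | h⟩ := hC.exists_dart d
  · refine ⟨c, hc, m, Or.inl fun k => ?_⟩
    suffices c.dart (m + k) = (next (vertexState C))^[k] d from congrArg Dart.tail this
    induction k with
    | zero => simpa using h
    | succ k ih =>
      rw [Function.iterate_succ_apply', ← ih, ← hC.track hc, Nat.cast_succ, add_assoc]
  · refine ⟨c, hc, m + 1, Or.inr fun k => ?_⟩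
    suffices (c.dart (m - k)).flip = (next (vertexState C))^[k] d by
      rw [← this, Dart.flip_tail, ← c.dart_succ_tail]
      exact congrArg c.pt (by ring)
    induction k with
    | zero => simp [h]
    | succ k ih =>
      have h1 := hC.track hc (m - (k + 1 : ℕ))
      rw [show m - ((k + 1 : ℕ) : ℤ) + 1 = m - k by push_cast; ring] at h1
      rw [Function.iterate_succ_apply', ← ih, h1, next_flip_next]

theorem Central.isGeneratedBy {τ : ℕ → Letter} {z : ℕ → GaussianInt} (hz : Central τ z)
    (hC : IsCovering C) (hv : ∀ n, (τ n).Valid (levelState τ (vertexState C) n)) {d : Dart}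
    (hd : d.tail = z 0) : IsGeneratedBy C (walk (vertexState C) d) := by
  intro j
  obtain ⟨c, hc, m, h⟩ := hC.exists_walk ((rotAt (z 0))^[(j : ℕ)] d)
  refine ⟨c, hc, m, ?_⟩
  have key : ∀ k, (walk (vertexState C) d).rotPt j k =
      ((next (vertexState C))^[k] ((rotAt (z 0))^[(j : ℕ)] d)).tail := fun k => by
    rw [hz.tail_iterate_rotAt hv hd, ← hd]; rfl
  simpa only [key] using h

theorem IsCovering.encard_eq_card (hC : IsCovering C) {O : Finset GaussianInt}
    {P : GaussianInt → Dart}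
    (h1 : ∀ M ∈ O, ∀ M' ∈ O, Conn (vertexState C) (P M) (P M') → M = M')
    (h2 : ∀ d, ∃ M ∈ O, Conn (vertexState C) d (P M)) : C.encard = O.card := by
  choose cur hcur hcon using fun d => hC.exists_dart d
  have himg : C = (fun M => cur (P M)) '' (O : Set GaussianInt) := by
    ext c
    constructor
    · intro hc
      obtain ⟨M, hM, h⟩ := h2 (c.dart 0)
      exact ⟨M, hM, hC.eq_of_contains (hcur _) hc (hcon _)
        ((hC.contains_iff_of_conn hc h).1 ⟨0, Or.inl rfl⟩)⟩
    · rintro ⟨M, -, rfl⟩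
      exact hcur _
  rw [himg, Set.InjOn.encard_image, Set.encard_coe_eq_coe_finsetCard]
  intro M hM M' hM' h
  refine h1 M hM M' hM' (hC.conn_of_contains (hcur (P M)) (hcon (P M)) ?_)
  have h' : cur (P M) = cur (P M') := h
  rw [h']
  exact hcon (P M')

theorem IsCovering.exists_unconnected (hC : IsCovering C) {n : ℕ} (hn : (n : ℕ∞) ≤ C.encard) :
    ∃ X : Finset Dart, X.card = n ∧ ∀ d ∈ X, ∀ e ∈ X, Conn (vertexState C) d e → d = e := by
  classical
  obtain ⟨B, hB, hBn⟩ := Set.exists_subset_encard_eq hn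
  have hfin : B.Finite := Set.finite_of_encard_eq_coe hBn
  have hinj : ∀ c ∈ B, ∀ c' ∈ B, Conn (vertexState C) (c.dart 0) (c'.dart 0) → c = c' :=
    fun c hc c' hc' h => hC.eq_of_contains (hB hc) (hB hc')
      ((hC.contains_iff_of_conn (hB hc) h).1 ⟨0, Or.inl rfl⟩) ⟨0, Or.inl rfl⟩
  refine ⟨hfin.toFinset.image fun c => c.dart 0, ?_, ?_⟩
  · rw [Finset.card_image_of_injOn]
    · rw [hfin.encard_eq_coe_toFinset_card] at hBn
      exact_mod_cast hBn
    · intro c hc c' hc' h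
      refine hinj c (by simpa using hc) c' (by simpa using hc') ?_
      have h' : c.dart 0 = c'.dart 0 := h
      rw [h']
      exact Conn.refl _
  · intro d hd e he h
    simp only [Finset.mem_image, Set.Finite.mem_toFinset] at hd he
    obtain ⟨c, hc, rfl⟩ := hd
    obtain ⟨c', hc', rfl⟩ := he
    rw [hinj c hc c' hc' h]

end

end PaperFolding

open PaperFolding in
theorem theorem6 (C : Set PaperFolding.CompleteCurve)
    (hcov : PaperFolding.IsCovering C)
    (hfold : ∀ c ∈ C, c.IsFolding)
    (hlip : PaperFolding.LocalIsomorphismProperty C) :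
    (C.encard = 1 ∨ C.encard = 2 ∨ C.encard = 3 ∨ C.encard = 4) ∨
      (C.encard = 6 ∧ ∃ D : PaperFolding.HalfCurve,
        PaperFolding.IsAlternatingOrPrimitive D.turn ∧ PaperFolding.IsGeneratedBy C D) := by
  obtain ⟨τ, hτ⟩ := exists_letters hcov hfold hlip
  have hv := valid_levelState hτ
  obtain ⟨c, hc, -⟩ := hcov.exists_dart ⟨0, 1, one_mem⟩
  have hpos : C.encard ≠ 0 := Set.encard_ne_zero.2 ⟨c, hc⟩
  by_cases h : ((5 : ℕ) : ℕ∞) ≤ C.encard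
  · right
    obtain ⟨X, hX, hX'⟩ := hcov.exists_unconnected h
    obtain ⟨z, n₀, hp, hall⟩ := exists_pinwheels hv X hX hX'
    obtain ⟨P, O, hO, h1, h2⟩ := hp.exists_six hv hall
    refine ⟨by rw [hcov.encard_eq_card h1 h2, hO]; rfl,
      walk (vertexState C) ⟨z 0, 1, one_mem⟩, hp.isAlternatingOrPrimitive hv rfl,
      hp.central.isGeneratedBy hcov hv rfl⟩
  · left
    rw [not_le] at h
    obtain ⟨m, hm⟩ := ENat.ne_top_iff_exists.1 h.ne_top
    rw [← hm] at h hpos ⊢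
    norm_cast at h hpos ⊢
    omega
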